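/- Let $d\ge 1$. There are constants $C_1, C_2$ depending only on $d$ such that the following holds for every field $\mathbb F$, every integer $n\ge 1$, and every ideal $I$ of $\mathbb F[x_1,\dots,x_d]$ with $\dim_{\mathbb F}\mathbb F[x_1,\dots,x_d]/I=n$ (that is, every $I\in\mathrm{Hilb}_n^d$). (1) The number of distinct reduced Gröbner bases of $I$, taken over all monomial orders, is finite and at most $C_1\, n^{2d\frac{d-1}{d+1}}$. (2) The universal Gröbner basis of $I$, defined as the union of all reduced Gröbner bases of $I$ over all monomial orders, is finite and has at most $C_2\, n^{2d-3+\frac{3d-1}{d(d+1)}}$ elements. -/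

import Mathlib

namespace HilbertGroebner

open MvPolynomial

variable {F : Type*} [Field F] {d : ℕ}

/-- `Hilb_n^d`: the ideals `I` of `F[x_1, …, x_d]` of length `n`, that is, such that the quotient
`F[x] / I` has dimension exactly `n` over `F`. -/
def Hilb (F : Type*) [Field F] (n d : ℕ) : Set (Ideal (MvPolynomial (Fin d) F)) :=
  {I | Module.rank F (MvPolynomial (Fin d) F ⧸ I) = (n : Cardinal)}

/-- The initial monomial `in_≺(f)` of a polynomial `f ≠ 0` under the monomial order `m`. -/
noncomputable def initialMonomial (m : MonomialOrder (Fin d)) (f : MvPolynomial (Fin d) F) :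
    MvPolynomial (Fin d) F :=
  monomial (m.degree f) 1

/-- The ideal generated by the initial monomials of the nonzero members of `S`. For the underlying
set of an ideal `I` this is the initial ideal `in_≺(I)`. -/
noncomputable def initialIdeal (m : MonomialOrder (Fin d)) (S : Set (MvPolynomial (Fin d) F)) :
    Ideal (MvPolynomial (Fin d) F) :=
  Ideal.span (initialMonomial m '' {f ∈ S | f ≠ 0})

/-- `G` is a Gröbner basis of `I` under `m`: a finite subset of `I` whose initial monomials
generate the initial ideal of `I`. -/
structure IsGroebnerBasis (m : MonomialOrder (Fin d)) (I : Ideal (MvPolynomial (Fin d) F))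
    (G : Set (MvPolynomial (Fin d) F)) : Prop where
  finite : G.Finite
  subset : G ⊆ I
  initialIdeal_eq : initialIdeal m G = initialIdeal m (I : Set (MvPolynomial (Fin d) F))

/-- `G` is a reduced Gröbner basis of `I` under `m`: a Gröbner basis whose members have leading
coefficient one, and such that no monomial occurring in a member `g` of `G` is divisible by the
initial monomial of another member of `G`. (Divisibility of monomials is the coordinatewise order
of the exponents.) -/
structure IsReducedGroebnerBasis (m : MonomialOrder (Fin d)) (I : Ideal (MvPolynomial (Fin d) F))
    (G : Set (MvPolynomial (Fin d) F)) : Prop extends IsGroebnerBasis m I G where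
  leadingCoeff_eq_one : ∀ g ∈ G, m.leadingCoeff g = 1
  not_degree_le : ∀ g ∈ G, ∀ h ∈ G, h ≠ g → ∀ u ∈ g.support, ¬ m.degree h ≤ u

/-- The set of all reduced Gröbner bases of `I`, under all monomial orders. (The carrier of a
monomial order is in bijection with the countable set of exponents, so that taking it in the lowest
universe loses no order.) -/
def reducedGroebnerBases (I : Ideal (MvPolynomial (Fin d) F)) :
    Set (Set (MvPolynomial (Fin d) F)) :=
  {G | ∃ m : MonomialOrder.{0, 0} (Fin d), IsReducedGroebnerBasis m I G}

/-- The universal Gröbner basis `𝒰(I)`: the union of all reduced Gröbner bases of `I`. -/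
def universalGroebnerBasis (I : Ideal (MvPolynomial (Fin d) F)) :
    Set (MvPolynomial (Fin d) F) :=
  ⋃₀ reducedGroebnerBases I

end HilbertGroebner

/-! For each monomial order the standard monomials form a basis of the quotient, and this set of `n`
exponents determines the reduced Gröbner basis. Attach to an order the sum of its standard
exponents, a lattice point of `[0, n²]^d`. A nonzero term in the determinant of the base change
between two standard bases shows that, in the order itself, this sum is strictly below the sum for
any other standard set (`toSyn_exponentSum_lt`). Hence the point determines the reduced basis. On
finitely many comparisons an order agrees with a positive rational weight
(`exists_positive_weight`), so each such point is the unique minimizer of a positive weight among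
all of them, a vertex of their convex hull.

It remains to bound the vertices of a lattice polytope in `[0, N]^d` by `O(N^(d(d-1)/(d+1)))` and to
put `N = n²`. After a harmless enlargement of the point set, choose at each vertex `v` a matrix of
`d` independent primitive facet normals, and let `E_v` be its entry sum. Two packing arguments bound
these sums. Parallelepipeds in the normal cones overlap in null sets, so `∑ E_v^(-d) ≤ 2^d`
(`sum_inv_entrySum_pow_le`). Prisms erected on the facets pack into a cube, so `∑ E_v = O(N^(d-1))`
(`sum_entrySum_le`). Since `1 ≤ x + x^(-d)` for `x > 0`, a suitable rescaling of `E_v` turns both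
into a bound on the number of vertices.

For the universal basis, the degrees in one reduced basis are distinct minimal nonstandard
exponents, of which there are `O(n^((d-1)/d))` (`card_le_rpow_of_antichain`). Multiplying by the
number of reduced bases gives the second bound. -/

/-! ### Separation and extreme rays of dual cones over an ordered field -/

/-- Fourier–Motzkin elimination: if `w` is positive on all vectors but `z`, combine each of them
with `z` into the kernel of `w`, find `u` positive on the combinations, and correct `u` by a
multiple of `w`. -/
theorem exists_dual_pos_of_blunt {K E : Type*} [Field K] [LinearOrder K] [IsStrictOrderedRing K]
    [AddCommGroup E] [Module K E] (P : E → Prop) (hadd : ∀ a b, P a → P b → P (a + b))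
    (hsmul : ∀ (c : K) a, 0 < c → P a → P (c • a)) (h0 : ¬ P 0) (A : Finset E)
    (hA : ∀ a ∈ A, P a) : ∃ w : Module.Dual K E, ∀ a ∈ A, 0 < w a := by
  classical
  induction hk : A.card using Nat.strong_induction_on generalizing A with
  | _ k ih =>
    subst hk
    rcases A.eq_empty_or_nonempty with rfl | ⟨z, hz⟩
    · exact ⟨0, by simp⟩
    set B := A.erase z with hB
    have hcard : B.card < A.card := Finset.card_erase_lt_of_mem hz
    have hBA : ∀ a ∈ B, P a := fun a ha => hA a (Finset.mem_of_mem_erase ha)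
    obtain ⟨w, hw⟩ := ih _ hcard B hBA rfl
    have key : ∀ w' : Module.Dual K E, (∀ a ∈ B, 0 < w' a) → 0 < w' z →
        ∃ w : Module.Dual K E, ∀ a ∈ A, 0 < w a := fun w' h1 h2 => ⟨w', fun a ha => by
      by_cases h : a = z
      · rwa [h]
      · exact h1 a (Finset.mem_erase.2 ⟨h, ha⟩)⟩
    rcases lt_or_ge 0 (w z) with hpos | hneg
    · exact key w hw hpos
    set f : E → E := fun a => w a • z + (- w z) • a with hf
    have hfP : ∀ b ∈ B.image f, P b := by
      intro b hb
      obtain ⟨a, ha, rfl⟩ := Finset.mem_image.1 hb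
      have h1 := hsmul _ _ (hw a ha) (hA z hz)
      rcases hneg.eq_or_lt with h | h
      · simpa [hf, h] using h1
      · exact hadd _ _ h1 (hsmul _ _ (neg_pos.2 h) (hBA a ha))
    obtain ⟨u, hu⟩ := ih _ (Finset.card_image_le.trans_lt hcard) (B.image f) hfP rfl
    have hu' : ∀ a ∈ B, 0 < w a * u z + (- w z) * u a := by
      intro a ha
      simpa [hf] using hu _ (Finset.mem_image_of_mem f ha)
    -- If `w z = 0`, each `f a` is a positive multiple of `z`, so `u z > 0` as soon as another
    -- vector exists; otherwise `z ≠ 0` alone suffices.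
    rcases hneg.eq_or_lt with h | h
    · rcases B.eq_empty_or_nonempty with hBe | ⟨b, hb⟩
      · have hz0 : z ≠ 0 := fun h => h0 (h ▸ hA z hz)
        obtain ⟨g, hg⟩ : ∃ g : Module.Dual K E, g z ≠ 0 := by
          by_contra! hcon
          exact hz0 ((Module.forall_dual_apply_eq_zero_iff K z).1 hcon)
        refine key (g z • g) (by simp [hBe]) ?_
        simpa using mul_self_pos.2 hg
      · have huz : 0 < u z := by
          have := hu' b hb
          rw [h] at this
          simp only [neg_zero, zero_mul, add_zero] at this
          exact (pos_iff_pos_of_mul_pos this).1 (hw b hb)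
        obtain ⟨t, ht⟩ : ∃ t : K, ∀ a ∈ B, - u a / w a < t := by
          obtain ⟨t, ht⟩ := (B.image fun a => - u a / w a).exists_le
          exact ⟨t + 1, fun a ha => (ht _ (Finset.mem_image_of_mem _ ha)).trans_lt (lt_add_one t)⟩
        refine key (u + t • w) (fun a ha => ?_) (by simpa [h] using huz)
        have := (div_lt_iff₀ (hw a ha)).1 (ht a ha)
        simp; linarith
    -- Positivity of `u + t • w` bounds `t` below at each `a` and above at `z`, where `w` is
    -- negative. Positivity of `u` on `f a` says exactly that these bounds are compatible.
    · obtain ⟨t, ht1, ht2⟩ : ∃ t : K, (∀ a ∈ B, - u a / w a < t) ∧ t < - u z / w z := by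
        obtain ⟨t, h1, h2⟩ := Finset.exists_between' (B.image fun a => - u a / w a)
          {- u z / w z} (by
            intro x hx y hy
            obtain ⟨a, ha, rfl⟩ := Finset.mem_image.1 hx
            rw [Finset.mem_singleton.1 hy, div_lt_iff₀ (hw a ha), div_mul_eq_mul_div,
              lt_div_iff_of_neg h]
            linarith [hu' a ha])
        exact ⟨t, fun a ha => h1 _ (Finset.mem_image_of_mem _ ha), h2 _ (by simp)⟩
      refine key (u + t • w) (fun a ha => ?_) ?_
      · have := (div_lt_iff₀ (hw a ha)).1 (ht1 a ha)
        simp; linarith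
      · have := (lt_div_iff_of_neg h).1 ht2
        simp; linarith

/-- The functionals that are nonnegative on `A` and whose zeros in `A` span their kernel. -/
def extremalFunctionals {K E : Type*} [Field K] [LinearOrder K]
    [AddCommGroup E] [Module K E] (A : Finset E) : Set (Module.Dual K E) :=
  {e | (∀ a ∈ A, 0 ≤ e a) ∧ e ≠ 0 ∧ ∀ x, e x = 0 → x ∈ Submodule.span K {a | a ∈ A ∧ e a = 0}}

/-- Induction on the number of points of `A` where `w` does not vanish. If `w` is not extremal, some
`u` vanishes at the zeros of `w` in `A` without being a multiple of `w`. Using the least and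
greatest ratios `u a / w a`, one gets two nonnegative functionals with more zeros whose sum is a
nonzero multiple of `w`. -/
theorem mem_span_extremalFunctionals {K E : Type*} [Field K] [LinearOrder K]
    [IsStrictOrderedRing K] [AddCommGroup E] [Module K E] (A : Finset E)
    (hspan : Submodule.span K (A : Set E) = ⊤) (w : Module.Dual K E) (hw : ∀ a ∈ A, 0 ≤ w a) :
    w ∈ Submodule.span K (extremalFunctionals (K := K) A) := by
  classical
  induction hk : (A.filter fun a => w a ≠ 0).card using Nat.strong_induction_on generalizing w with
  | _ k ih =>
    subst hk
    by_cases hw0 : w = 0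
    · simp [hw0]
    by_cases hE : w ∈ extremalFunctionals (K := K) A
    · exact Submodule.subset_span hE
    obtain ⟨x, hx0, hx⟩ : ∃ x, w x = 0 ∧ x ∉ Submodule.span K {a | a ∈ A ∧ w a = 0} := by
      by_contra! hcon
      exact hE ⟨hw, hw0, hcon⟩
    obtain ⟨u, hux, hu⟩ := Submodule.exists_le_ker_of_notMem hx
    have hu' : ∀ a ∈ A, w a = 0 → u a = 0 := fun a ha h =>
      hu (Submodule.subset_span (show a ∈ {a | a ∈ A ∧ w a = 0} from ⟨ha, h⟩))
    have ext0 : ∀ f : Module.Dual K E, (∀ a ∈ A, f a = 0) → f = 0 := fun f hf => by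
      refine LinearMap.ext_on hspan fun a ha => ?_
      simpa using hf a ha
    have hne : (A.filter fun a => w a ≠ 0).Nonempty := by
      by_contra hcon
      refine hw0 (ext0 w fun a ha => ?_)
      by_contra h
      exact hcon ⟨a, by simp [ha, h]⟩
    have step : ∀ f : Module.Dual K E, (∀ a ∈ A, 0 ≤ f a) → (∀ a ∈ A, w a = 0 → f a = 0) →
        (∃ a ∈ A, w a ≠ 0 ∧ f a = 0) → f ∈ Submodule.span K (extremalFunctionals (K := K) A) := by
      intro f hf1 hf2 ⟨a, ha, hwa, hfa⟩
      refine ih _ (Finset.card_lt_card ?_) f hf1 rfl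
      refine ⟨fun b hb => ?_, fun hsub => ?_⟩
      · simp only [Finset.mem_filter] at hb ⊢
        exact ⟨hb.1, fun h => hb.2 (hf2 b hb.1 h)⟩
      · have := hsub (show a ∈ _ by simp [ha, hwa])
        simp [hfa] at this
    obtain ⟨p, hp, hpmin⟩ := Finset.exists_min_image _ (fun a => u a / w a) hne
    obtain ⟨q, hq, hqmax⟩ := Finset.exists_max_image _ (fun a => u a / w a) hne
    simp only [Finset.mem_filter, ne_eq] at hp hq hpmin hqmax
    have h1 := step (u - (u p / w p) • w) (fun a ha => ?_) (fun a ha h => by simp [h, hu' a ha h])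
      ⟨p, hp.1, hp.2, by simp [div_mul_cancel₀ _ hp.2]⟩
    · have h2 := step ((u q / w q) • w - u) (fun a ha => ?_)
        (fun a ha h => by simp [h, hu' a ha h]) ⟨q, hq.1, hq.2, by simp [div_mul_cancel₀ _ hq.2]⟩
      · have h3 := Submodule.add_mem _ h1 h2
        have h4 : u - (u p / w p) • w + ((u q / w q) • w - u) = (u q / w q - u p / w p) • w := by
          module
        rw [h4] at h3
        by_cases h5 : u q / w q - u p / w p = 0
        · exfalso
          have : u = (u p / w p) • w := by
            rw [← sub_eq_zero]
            refine ext0 _ fun a ha => ?_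
            by_cases hwa : w a = 0
            · simp [hwa, hu' a ha hwa]
            · have e1 := hpmin a ⟨ha, hwa⟩
              have e2 := hqmax a ⟨ha, hwa⟩
              have e3 : u p / w p = u a / w a := le_antisymm e1 (by linarith)
              simp [e3, div_mul_cancel₀ _ hwa]
          apply hux
          rw [this]
          simp [hx0]
        · exact (Submodule.smul_mem_iff _ h5).1 h3
      · by_cases hwa : w a = 0
        · simp [hwa, hu' a ha hwa]
        · have hpos : 0 < w a := lt_of_le_of_ne (hw a ha) (Ne.symm hwa)
          have := hqmax a ⟨ha, hwa⟩
          rw [div_le_iff₀ hpos] at this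
          simpa using this
    · by_cases hwa : w a = 0
      · simp [hwa, hu' a ha hwa]
      · have hpos : 0 < w a := lt_of_le_of_ne (hw a ha) (Ne.symm hwa)
        have := hpmin a ⟨ha, hwa⟩
        rw [le_div_iff₀ hpos] at this
        simpa using this

/-- The cone of nonnegative functionals spans the dual: for large `t` both `f + t • w` and `w` lie
in it. -/
theorem span_extremalFunctionals {K E : Type*} [Field K] [LinearOrder K]
    [IsStrictOrderedRing K] [AddCommGroup E] [Module K E] (A : Finset E)
    (hspan : Submodule.span K (A : Set E) = ⊤) (w : Module.Dual K E)
    (hw : ∀ a ∈ A, a ≠ 0 → 0 < w a) :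
    Submodule.span K (extremalFunctionals (K := K) A) = ⊤ := by
  classical
  rw [eq_top_iff]
  intro f _
  obtain ⟨t, ht⟩ := (A.image fun a => - f a / w a).exists_le
  have h1 := mem_span_extremalFunctionals A hspan w fun a ha => by
    by_cases h : a = 0
    · simp [h]
    · exact (hw a ha h).le
  have h2 := mem_span_extremalFunctionals A hspan (f + t • w) fun a ha => by
    by_cases h : a = 0
    · simp [h]
    · have := (div_le_iff₀ (hw a ha h)).1 (ht _ (Finset.mem_image_of_mem _ ha))
      simp; linarith
  simpa using Submodule.sub_mem _ h2 (Submodule.smul_mem _ t h1)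

/-! ### Counting points of a lattice coset in a convex body -/

section LatticeGeometry

open MeasureTheory Module

/-- The inclusion of `ℤ^d` into `ℝ^d`. -/
def intVecToReal (d : ℕ) : (Fin d → ℤ) →+ (Fin d → ℝ) := (Int.castAddHom ℝ).compLeft (Fin d)

@[simp]
theorem intVecToReal_apply {d : ℕ} (x : Fin d → ℤ) (i : Fin d) : intVecToReal d x i = x i := rfl

theorem index_closure_rows {d : ℕ} (B : Matrix (Fin d) (Fin d) ℤ) (hB : B.det ≠ 0) :
    (AddSubgroup.closure (Set.range B)).index = B.det.natAbs := by
  have hli : LinearIndependent ℤ B.row := Matrix.linearIndependent_rows_of_det_ne_zero hB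
  let bN := Basis.span hli
  have hsub : AddSubgroup.closure (Set.range B) =
      (Submodule.span ℤ (Set.range B)).toAddSubgroup :=
    (Submodule.span_int_eq_addSubgroupClosure _).symm
  rw [hsub, AddSubgroup.index_eq_natAbs_det (Pi.basisFun ℤ (Fin d)) _
    (bN : Basis (Fin d) ℤ (Submodule.span ℤ (Set.range B)))]
  congr 1
  rw [Basis.det_apply, ← Matrix.det_transpose B]
  congr 1
  ext i j
  simp only [Basis.toMatrix_apply, bN, Pi.basisFun_repr, Matrix.transpose_apply]
  exact congrFun (congrArg Subtype.val (Basis.span_apply hli j)) i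

/-- A coset of a subgroup `Λ` of `ℤ^d` has few points in a convex set containing a basis of
`ℝ^d` consisting of vectors of `Λ`, placed at a point of the coset. -/
theorem card_mul_index_le_volume {d : ℕ} (K : Set (Fin d → ℝ)) (hK : Convex ℝ K)
    (hKfin : volume K ≠ ⊤) (Λ : AddSubgroup (Fin d → ℤ)) (v : Fin d → ℤ)
    (B : Matrix (Fin d) (Fin d) ℤ) (hB : B.det ≠ 0) (hBΛ : ∀ i, B i ∈ Λ)
    (hv : intVecToReal d v ∈ K) (hBK : ∀ i, intVecToReal d (v + B i) ∈ K)
    (X : Finset (Fin d → ℤ)) (hXK : ∀ x ∈ X, intVecToReal d x ∈ K) (hXΛ : ∀ x ∈ X, x - v ∈ Λ) :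
    (X.card : ℝ) * Λ.index ≤ ((d : ℝ) + 1) ^ d * volume.real K := by
  classical
  set Λ' := AddSubgroup.closure (Set.range B) with hΛ'
  have hle : Λ' ≤ Λ := by
    rw [hΛ', AddSubgroup.closure_le]
    rintro _ ⟨i, rfl⟩
    exact hBΛ i
  have hidx : Λ'.index = B.det.natAbs := index_closure_rows B hB
  have hmul : Λ'.relIndex Λ * Λ.index = B.det.natAbs := by
    rw [← hidx]; exact AddSubgroup.relIndex_mul_index hle
  have hrel : Λ'.relIndex Λ ≠ 0 := fun h => hB (by simpa [h] using hmul.symm)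
  -- the real basis and its fundamental domain
  set BR : Matrix (Fin d) (Fin d) ℝ := B.map (Int.castRingHom ℝ) with hBR
  have hdet : BR.det = B.det := (RingHom.map_det (Int.castRingHom ℝ) B).symm
  have hli : LinearIndependent ℝ BR.row :=
    Matrix.linearIndependent_rows_of_det_ne_zero (show BR.det ≠ 0 by rw [hdet]; exact_mod_cast hB)
  let b : Basis (Fin d) ℝ (Fin d → ℝ) := basisOfPiSpaceOfLinearIndependent hli
  have hb : ∀ i, b i = intVecToReal d (B i) := fun i => by
    simp only [b, coe_basisOfPiSpaceOfLinearIndependent]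
    rfl
  have hvolQ : volume.real (ZSpan.fundamentalDomain b) = |(B.det : ℝ)| := by
    rw [ZSpan.volume_real_fundamentalDomain, ← hdet]
    congr 2
    ext i j
    simp [hb, BR]
  have hΛb : ∀ x ∈ Λ', intVecToReal d x ∈ Submodule.span ℤ (Set.range b) := by
    intro x hx
    induction hx using AddSubgroup.closure_induction with
    | mem x hx =>
      obtain ⟨i, rfl⟩ := hx
      rw [← hb]
      exact Submodule.subset_span ⟨i, rfl⟩
    | zero => simp
    | add x y _ _ hx hy => rw [map_add]; exact Submodule.add_mem _ hx hy
    | neg x _ hx => rw [map_neg]; exact Submodule.neg_mem _ hx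
  -- The homothety is large enough to contain every translate of the fundamental domain by a point
  -- of `X`: relative to `v`, the point `x + ∑ t i • b i` is `d + 1` times the mean of `x` and the
  -- `d` points `v + t i • b i`, all in `K`.
  set D := AffineMap.homothety (intVecToReal d v) ((d : ℝ) + 1) '' K with hD
  have hvolD : volume D = ENNReal.ofReal (((d : ℝ) + 1) ^ d) * volume K := by
    rw [hD, Measure.addHaar_image_homothety]
    simp [abs_of_nonneg (by positivity : (0 : ℝ) ≤ (d : ℝ) + 1)]
  have hDfin : volume D ≠ ⊤ := by
    rw [hvolD]; exact ENNReal.mul_ne_top ENNReal.ofReal_ne_top hKfin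
  have hvolD' : volume.real D = ((d : ℝ) + 1) ^ d * volume.real K := by
    rw [Measure.real, hvolD, ENNReal.toReal_mul, ENNReal.toReal_ofReal (by positivity)]; rfl
  let T : (Fin d → ℤ) → Set (Fin d → ℝ) := fun x =>
    (fun y => y + -intVecToReal d x) ⁻¹' ZSpan.fundamentalDomain b
  have hTvol : ∀ x, volume.real (T x) = |(B.det : ℝ)| := fun x => by
    rw [← hvolQ, Measure.real, Measure.real, measure_preimage_add_right]
  have hTmeas : ∀ x, MeasurableSet (T x) := fun x =>
    (measurable_add_const _) (ZSpan.fundamentalDomain_measurableSet b)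
  have hTD : ∀ x ∈ X, T x ⊆ D := by
    intro x hx y hy
    have hd1 : (0 : ℝ) < (d : ℝ) + 1 := by positivity
    have ht : ∀ i, b.repr (y - intVecToReal d x) i ∈ Set.Ico (0 : ℝ) 1 := fun i => by
      simpa [T, sub_eq_add_neg] using (ZSpan.mem_fundamentalDomain b).1 hy i
    set t := fun i => b.repr (y - intVecToReal d x) i with htdef
    have hy' : y = intVecToReal d x + ∑ i, t i • b i := by
      rw [b.sum_repr]; abel
    have hp : ∀ i, intVecToReal d v + t i • b i ∈ K := fun i => by
      have h1 := hK hv (hBK i) (a := 1 - t i) (b := t i) (by linarith [(ht i).2]) (ht i).1 (by ring)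
      convert h1 using 1
      rw [map_add, ← hb]
      module
    let z : Fin (d + 1) → (Fin d → ℝ) :=
      Fin.cons (intVecToReal d x) fun i => intVecToReal d v + t i • b i
    have hz : ∑ i : Fin (d + 1), ((d : ℝ) + 1)⁻¹ • z i ∈ K := by
      refine hK.sum_mem (fun _ _ => by positivity) ?_ ?_
      · simp [hd1.ne']
      · intro i _
        refine Fin.cases ?_ (fun j => ?_) i
        · simpa [z] using hXK x hx
        · simpa [z] using hp j
    refine ⟨_, hz, ?_⟩
    rw [AffineMap.homothety_apply, ← Finset.smul_sum, Fin.sum_univ_succ]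
    simp only [z, Fin.cons_zero, Fin.cons_succ, vsub_eq_sub, vadd_eq_add, smul_sub,
      Finset.sum_add_distrib, Finset.sum_const, Finset.card_univ, Fintype.card_fin]
    rw [smul_smul, mul_inv_cancel₀ hd1.ne', hy', ← Nat.cast_smul_eq_nsmul ℝ]
    module
  -- Only translates by points congruent modulo `Λ'` are disjoint, so each class is packed
  -- separately. The number of classes then cancels against `|det B| = [Λ : Λ'] · [ℤ^d : Λ]`.
  let f : (Fin d → ℤ) → Λ ⧸ (Λ'.addSubgroupOf Λ) := fun x =>
    if h : x - v ∈ Λ then QuotientAddGroup.mk ⟨x - v, h⟩ else 0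
  have hff : ∀ x ∈ X, ∀ y ∈ X, f x = f y → y - x ∈ Λ' := by
    intro x hx y hy hxy
    simp only [f, dif_pos (hXΛ x hx), dif_pos (hXΛ y hy)] at hxy
    have := QuotientAddGroup.eq.1 hxy
    rw [AddSubgroup.mem_addSubgroupOf] at this
    convert this using 1
    simp
  have hfiber : ∀ c, (((X.filter fun x => f x = c).card : ℕ) : ℝ) * |(B.det : ℝ)| ≤
      volume.real D := by
    intro c
    have hdisj : Set.PairwiseDisjoint (↑(X.filter fun x => f x = c)) T := by
      intro x hx y hy hxy
      simp only [Finset.coe_filter, Set.mem_ofPred_eq] at hx hy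
      rw [Function.onFun, Set.disjoint_left]
      intro z hz1 hz2
      apply hxy
      have h1 := hΛb _ (hff x hx.1 y hy.1 (hx.2.trans hy.2.symm))
      have e1 := (ZSpan.fract_eq_self (b := b)).2 hz1
      have e2 := (ZSpan.fract_eq_self (b := b)).2 hz2
      have e3 : ZSpan.fract b (z + -intVecToReal d x) = ZSpan.fract b (z + -intVecToReal d y) := by
        rw [ZSpan.fract_eq_fract]
        rw [show -(z + -intVecToReal d x) + (z + -intVecToReal d y) =
          -(intVecToReal d (y - x)) by rw [map_sub]; abel]
        exact Submodule.neg_mem _ h1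
      rw [e1, e2] at e3
      have e4 := neg_injective (add_left_cancel e3)
      funext i
      simpa using congrFun e4 i
    have hsum := measureReal_biUnion_finset hdisj (fun x _ => hTmeas x) (μ := volume) (fun x hx => by
      refine ((measure_mono (hTD x (Finset.mem_filter.1 hx).1)).trans_lt hDfin.lt_top).ne)
    simp only [hTvol, Finset.sum_const, nsmul_eq_mul] at hsum
    rw [← hsum]
    exact measureReal_mono (Set.iUnion₂_subset fun x hx => hTD x (Finset.mem_filter.1 hx).1) hDfin
  have hfinq : Finite (Λ ⧸ (Λ'.addSubgroupOf Λ)) := 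
    @AddSubgroup.finite_quotient_of_finiteIndex _ _ _ ⟨hrel⟩
  have : Fintype (Λ ⧸ (Λ'.addSubgroupOf Λ)) := Fintype.ofFinite _
  have hcardq : Fintype.card (Λ ⧸ (Λ'.addSubgroupOf Λ)) = Λ'.relIndex Λ := by
    rw [← Nat.card_eq_fintype_card]; rfl
  have htot : (X.card : ℝ) * |(B.det : ℝ)| ≤ (Λ'.relIndex Λ : ℝ) * volume.real D := by
    rw [Finset.card_eq_sum_card_fiberwise (f := f) (t := Finset.univ) (fun _ _ => by simp)]
    rw [Nat.cast_sum, Finset.sum_mul, ← hcardq]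
    refine (Finset.sum_le_sum fun c _ => hfiber c).trans ?_
    simp
  have hdet2 : |(B.det : ℝ)| = (Λ'.relIndex Λ : ℝ) * Λ.index := by
    rw [← Nat.cast_mul, hmul, Nat.cast_natAbs, Int.cast_abs]
  rw [hdet2, hvolD'] at htot
  have hpos : (0 : ℝ) < Λ'.relIndex Λ := by positivity
  refine le_of_mul_le_mul_left ?_ hpos
  linarith

/-- The inclusion of `ℤ^d` into `ℚ^d`. -/
def intVecToRat (d : ℕ) : (Fin d → ℤ) →+ (Fin d → ℚ) := (Int.castAddHom ℚ).compLeft (Fin d)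

@[simp]
theorem intVecToRat_apply {d : ℕ} (x : Fin d → ℤ) (i : Fin d) : intVecToRat d x i = x i := rfl

theorem exists_matrix_of_span_eq_top {d : ℕ} (T : Set (Fin d → ℤ))
    (hT : Submodule.span ℚ (intVecToRat d '' T) = ⊤) :
    ∃ B : Matrix (Fin d) (Fin d) ℤ, (∀ i, B i ∈ T) ∧ B.det ≠ 0 := by
  classical
  let b := Basis.ofSpan hT.ge
  have hfin : Fintype ((linearIndepOn_empty ℚ id).extend (Set.empty_subset (intVecToRat d '' T)) :
    Set (Fin d → ℚ)) := FiniteDimensional.fintypeBasisIndex b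
  have hcard := Module.finrank_eq_card_basis b
  rw [Module.finrank_fin_fun] at hcard
  let c := b.reindex (Fintype.equivFinOfCardEq hcard.symm)
  have hc : ∀ i, c i ∈ intVecToRat d '' T := fun i => by
    apply Basis.ofSpan_subset hT.ge
    simp only [c, Basis.reindex_apply]
    exact ⟨_, rfl⟩
  choose B hBT hBc using hc
  refine ⟨Matrix.of B, hBT, fun h => ?_⟩
  have h1 : ((Matrix.of B).map (Int.castRingHom ℚ)).det = 0 := by
    have := RingHom.map_det (Int.castRingHom ℚ) (Matrix.of B)
    rw [h] at this
    simpa using this.symm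
  have h2 : (Matrix.of B).map (Int.castRingHom ℚ) = Matrix.of fun i => c i := by
    ext i j
    simp [← hBc]
  have h3 : LinearIndependent ℚ (Matrix.of fun i => c i).row := c.linearIndependent
  rw [Matrix.linearIndependent_rows_iff_isUnit, Matrix.isUnit_iff_isUnit_det, ← h2, h1] at h3
  simp at h3

theorem volume_affine_hyperplane {d : ℕ} (a : Fin d → ℝ) (ha : a ≠ 0) (c : ℝ) :
    volume {z : Fin d → ℝ | a ⬝ᵥ z = c} = 0 := by
  rcases Set.eq_empty_or_nonempty {z : Fin d → ℝ | a ⬝ᵥ z = c} with h | ⟨z, hz⟩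
  · simp [h]
  let s : AffineSubspace ℝ (Fin d → ℝ) :=
    AffineSubspace.mk' z (LinearMap.ker (dotProductBilin ℝ ℝ a))
  have hs : s ≠ ⊤ := by
    intro h
    have h1 : z + a ∈ s := by rw [h]; trivial
    rw [AffineSubspace.mem_mk'] at h1
    simp at h1
    exact ha h1
  refine measure_mono_null (fun y hy => ?_) (Measure.addHaar_affineSubspace volume s hs)
  show y ∈ s
  rw [AffineSubspace.mem_mk']
  simp only [Set.mem_ofPred_eq] at hy hz
  simp [dotProduct_sub, hy, hz]

/-! ### Prisms on facets and the sum of facet normals -/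

/-- The polytope cut out of the cube `[0,N]^d` by the inequalities `b ≤ n ⬝ᵥ x` for `(n, b) ∈ 𝓕`. -/
def cubeSection {d : ℕ} (N : ℝ) (𝓕 : Finset ((Fin d → ℤ) × ℤ)) : Set (Fin d → ℝ) :=
  {x | (∀ i, 0 ≤ x i ∧ x i ≤ N) ∧ ∀ G ∈ 𝓕, (G.2 : ℝ) ≤ intVecToReal d G.1 ⬝ᵥ x}

/-- The position of `x` in direction `e_j` above the hyperplane `n ⬝ᵥ x = b`, where `F = (n, b)`. -/
noncomputable def facetHeight {d : ℕ} (j : Fin d) (F : (Fin d → ℤ) × ℤ) (x : Fin d → ℝ) : ℝ :=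
  (intVecToReal d F.1 ⬝ᵥ x - F.2) / F.1 j

/-- The prism of height `N` in direction `e_j` on the facet of `cubeSection N 𝓕` in the
hyperplane `n ⬝ᵥ x = b`, where `F = (n, b)`. -/
def facetPrism {d : ℕ} (N : ℝ) (𝓕 : Finset ((Fin d → ℤ) × ℤ)) (j : Fin d)
    (F : (Fin d → ℤ) × ℤ) : Set (Fin d → ℝ) :=
  {x | 0 ≤ facetHeight j F x ∧ facetHeight j F x ≤ N ∧
    x - Pi.single j (facetHeight j F x) ∈ cubeSection N 𝓕}

section Prism

variable {d : ℕ} {N : ℝ} {𝓕 : Finset ((Fin d → ℤ) × ℤ)} {j : Fin d} {F : (Fin d → ℤ) × ℤ}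

theorem convex_cubeSection : Convex ℝ (cubeSection N 𝓕) := by
  intro x hx y hy a c ha hc hac
  refine ⟨fun i => ?_, fun G hG => ?_⟩
  · have h1 := hx.1 i
    have h2 := hy.1 i
    simp only [Pi.add_apply, Pi.smul_apply, smul_eq_mul]
    constructor
    · nlinarith
    · calc a * x i + c * y i ≤ a * N + c * N := by gcongr <;> [exact h1.2; exact h2.2]
        _ = N := by rw [← add_mul, hac, one_mul]
  · have h1 := hx.2 G hG
    have h2 := hy.2 G hG
    rw [dotProduct_add, dotProduct_smul, dotProduct_smul, smul_eq_mul, smul_eq_mul]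
    calc (G.2 : ℝ) = a * G.2 + c * G.2 := by rw [← add_mul, hac, one_mul]
      _ ≤ _ := by gcongr

theorem isClosed_cubeSection : IsClosed (cubeSection N 𝓕) := by
  have h : cubeSection N 𝓕 = (⋂ i, {x : Fin d → ℝ | 0 ≤ x i} ∩ {x | x i ≤ N}) ∩
      ⋂ G ∈ 𝓕, {x | (G.2 : ℝ) ≤ intVecToReal d G.1 ⬝ᵥ x} := by
    ext x
    simp [cubeSection]
  rw [h]
  refine (isClosed_iInter fun i => ?_).inter (isClosed_biInter fun G _ => ?_)
  · exact (isClosed_le continuous_const (continuous_apply i)).inter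
      (isClosed_le (continuous_apply i) continuous_const)
  · exact isClosed_le continuous_const (by unfold dotProduct; fun_prop)

theorem continuous_facetHeight : Continuous (facetHeight j F) := by
  unfold facetHeight dotProduct
  fun_prop

theorem facetHeight_combo {x y : Fin d → ℝ} {a c : ℝ} (hac : a + c = 1) :
    facetHeight j F (a • x + c • y) = a * facetHeight j F x + c * facetHeight j F y := by
  unfold facetHeight
  rw [dotProduct_add, dotProduct_smul, dotProduct_smul, smul_eq_mul, smul_eq_mul]
  have : (F.2 : ℝ) = a * F.2 + c * F.2 := by rw [← add_mul, hac, one_mul]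
  nth_rw 1 [this]
  ring

theorem convex_facetPrism : Convex ℝ (facetPrism N 𝓕 j F) := by
  intro x hx y hy a c ha hc hac
  refine ⟨?_, ?_, ?_⟩
  · rw [facetHeight_combo hac]
    have := hx.1
    have := hy.1
    positivity
  · rw [facetHeight_combo hac]
    calc _ ≤ a * N + c * N := by gcongr <;> [exact hx.2.1; exact hy.2.1]
        _ = N := by rw [← add_mul, hac, one_mul]
  · have := convex_cubeSection hx.2.2 hy.2.2 ha hc hac
    convert this using 1
    rw [facetHeight_combo hac]
    ext i
    by_cases h : i = j
    · subst h; simp; ring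
    · simp [h]

theorem isClosed_facetPrism : IsClosed (facetPrism N 𝓕 j F) := by
  refine (isClosed_le continuous_const continuous_facetHeight).inter
    ((isClosed_le continuous_facetHeight continuous_const).inter
    (isClosed_cubeSection.preimage ?_))
  refine continuous_pi fun i => ?_
  by_cases h : i = j
  · subst h
    simpa using! (continuous_apply i).sub continuous_facetHeight
  · simpa [h] using continuous_apply i

theorem facetPrism_subset_Icc (hN : 0 ≤ N) :
    facetPrism N 𝓕 j F ⊆ Set.Icc 0 (fun _ => 2 * N) := by
  intro x hx
  have h : ∀ i, 0 ≤ x i ∧ x i ≤ 2 * N := fun i => by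
    have h1 := hx.2.2.1 i
    have h2 := hx.1
    have h3 := hx.2.1
    by_cases h : i = j
    · subst h
      simp only [Pi.sub_apply, Pi.single_eq_same] at h1
      constructor <;> linarith
    · simp only [Pi.sub_apply, Pi.single_eq_of_ne h, sub_zero] at h1
      constructor <;> linarith
  exact ⟨fun i => (h i).1, fun i => (h i).2⟩

/-- Sliding a common point along `e_j` onto each hyperplane gives points that satisfy the inequality
of the other facet. With equal signs this forces the two heights to agree, which for nonparallel
normals is the equation of a hyperplane. -/
theorem aedisjoint_facetPrism {G : (Fin d → ℤ) × ℤ} (hF : F ∈ 𝓕) (hG : G ∈ 𝓕)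
    (hsign : 0 < F.1 j * G.1 j) (hpar : G.1 j • F.1 ≠ F.1 j • G.1) :
    AEDisjoint volume (facetPrism N 𝓕 j F) (facetPrism N 𝓕 j G) := by
  have hF0 : F.1 j ≠ 0 := fun h => by simp [h] at hsign
  have hG0 : G.1 j ≠ 0 := fun h => by simp [h] at hsign
  have hF0' : (F.1 j : ℝ) ≠ 0 := by exact_mod_cast hF0
  have hG0' : (G.1 j : ℝ) ≠ 0 := by exact_mod_cast hG0
  set a : Fin d → ℝ := intVecToReal d (G.1 j • F.1 - F.1 j • G.1) with ha
  have ha0 : a ≠ 0 := by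
    intro h
    apply hpar
    rw [← sub_eq_zero]
    funext i
    have := congrFun h i
    rw [ha, intVecToReal_apply, Pi.zero_apply] at this
    exact_mod_cast this
  refine measure_mono_null (fun z hz => ?_)
    (volume_affine_hyperplane a ha0 (G.1 j * F.2 - F.1 j * G.2))
  obtain ⟨h1, h2⟩ := hz
  have e1 : (F.1 j : ℝ) * facetHeight j F z = intVecToReal d F.1 ⬝ᵥ z - F.2 := by
    unfold facetHeight; field_simp
  have e2 : (G.1 j : ℝ) * facetHeight j G z = intVecToReal d G.1 ⬝ᵥ z - G.2 := by
    unfold facetHeight; field_simp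
  have i1 := h2.2.2.2 F hF
  have i2 := h1.2.2.2 G hG
  rw [dotProduct_sub, dotProduct_single, intVecToReal_apply] at i1 i2
  have hs : (0 : ℝ) < F.1 j * G.1 j := by exact_mod_cast hsign
  have heq : facetHeight j F z = facetHeight j G z := by
    have k1 : 0 ≤ (F.1 j : ℝ) * (facetHeight j F z - facetHeight j G z) := by linarith
    have k2 : 0 ≤ (G.1 j : ℝ) * (facetHeight j G z - facetHeight j F z) := by linarith
    have k3 : (F.1 j * G.1 j : ℝ) * (facetHeight j F z - facetHeight j G z) ^ 2 ≤ 0 := by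
      linarith [mul_nonneg k1 k2]
    have k4 := nonpos_of_mul_nonpos_right k3 hs
    exact sub_eq_zero.1 (pow_eq_zero_iff two_ne_zero |>.1 (le_antisymm k4 (sq_nonneg _)))
  show a ⬝ᵥ z = _
  have : a = (G.1 j : ℝ) • intVecToReal d F.1 - (F.1 j : ℝ) • intVecToReal d G.1 := by
    ext i; simp [ha]
  rw [this, sub_dotProduct, smul_dotProduct, smul_dotProduct, smul_eq_mul, smul_eq_mul]
  rw [heq] at e1
  linear_combination (-(G.1 j : ℝ)) * e1 + (F.1 j : ℝ) * e2

end Prism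

/-- `F = (n, b)` describes a facet of the convex hull of `S`: `n` is a primitive vector, `n ⬝ᵥ p`
has the lower bound `b` on `S`, and the points of `S` where it is attained span a hyperplane. -/
structure IsLatticeFacet {d : ℕ} (S : Finset (Fin d → ℤ)) (F : (Fin d → ℤ) × ℤ) : Prop where
  le : ∀ p ∈ S, F.2 ≤ F.1 ⬝ᵥ p
  primitive : ∃ u, F.1 ⬝ᵥ u = 1
  spans : ∃ v ∈ S, F.1 ⬝ᵥ v = F.2 ∧ ∀ x : Fin d → ℚ, intVecToRat d F.1 ⬝ᵥ x = 0 →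
    x ∈ Submodule.span ℚ (intVecToRat d '' {y | v + y ∈ S ∧ F.1 ⬝ᵥ (v + y) = F.2})

theorem intVecToReal_dotProduct {d : ℕ} (x y : Fin d → ℤ) :
    intVecToReal d x ⬝ᵥ intVecToReal d y = ((x ⬝ᵥ y : ℤ) : ℝ) := by
  simp [dotProduct]

/-- The facet points lie in one coset of the lattice of all `x` for which `N * F.1 j` divides `F.1
⬝ᵥ x`. Its index is exactly `N * |F.1 j|` because the normal is primitive, and it contains `N e_j`,
so a basis of lattice vectors fits inside the prism. -/
theorem IsLatticeFacet.card_mul_le {d : ℕ} {N : ℕ} (hN : 1 ≤ N) {S : Finset (Fin d → ℤ)}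
    {𝓕 : Finset ((Fin d → ℤ) × ℤ)} {F : (Fin d → ℤ) × ℤ} {j : Fin d}
    (hS : ∀ p ∈ S, ∀ i, 0 ≤ p i ∧ p i ≤ N) (h𝓕 : ∀ G ∈ 𝓕, ∀ p ∈ S, G.2 ≤ G.1 ⬝ᵥ p)
    (hF : IsLatticeFacet S F) (hj : F.1 j ≠ 0) :
    ((S.filter fun p => F.1 ⬝ᵥ p = F.2).card : ℝ) * (N * |(F.1 j : ℝ)|) ≤
      ((d : ℝ) + 1) ^ d * volume.real (facetPrism N 𝓕 j F) := by
  classical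
  obtain ⟨v, hvS, hvF, hspan⟩ := hF.spans
  have hj' : (F.1 j : ℝ) ≠ 0 := by exact_mod_cast hj
  have hNR : (1 : ℝ) ≤ N := by exact_mod_cast hN
  let φ : (Fin d → ℤ) →+ ℤ := (dotProductBilin ℤ ℤ F.1).toAddMonoidHom
  have hφ : ∀ x, φ x = F.1 ⬝ᵥ x := fun x => rfl
  have hφs : Function.Surjective φ := by
    obtain ⟨u, hu⟩ := hF.primitive
    intro c
    exact ⟨c • u, by rw [hφ, dotProduct_smul, hu]; simp⟩
  let Λ : AddSubgroup (Fin d → ℤ) := (AddSubgroup.zmultiples ((N : ℤ) * F.1 j)).comap φ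
  have hΛi : (Λ.index : ℝ) = N * |(F.1 j : ℝ)| := by
    rw [AddSubgroup.index_comap_of_surjective _ hφs, Int.index_zmultiples, Int.natAbs_mul]
    simp [Nat.cast_natAbs]
  have hmemP : ∀ p ∈ S, intVecToReal d p ∈ cubeSection (N : ℝ) 𝓕 := fun p hp =>
    ⟨fun i => by simpa using (by exact_mod_cast hS p hp i : (0 : ℝ) ≤ p i ∧ (p i : ℝ) ≤ N),
      fun G hG => by rw [intVecToReal_dotProduct]; exact_mod_cast h𝓕 G hG p hp⟩
  have hmem : ∀ p ∈ S, F.1 ⬝ᵥ p = F.2 → intVecToReal d p ∈ facetPrism N 𝓕 j F := by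
    intro p hp hpF
    have h0 : facetHeight j F (intVecToReal d p) = 0 := by
      rw [facetHeight, intVecToReal_dotProduct, hpF]; simp
    refine ⟨h0.ge, by rw [h0]; positivity, ?_⟩
    rw [h0, Pi.single_zero, sub_zero]
    exact hmemP p hp
  have hmemj : intVecToReal d (v + Pi.single j (N : ℤ)) ∈ facetPrism N 𝓕 j F := by
    have h0 : facetHeight j F (intVecToReal d (v + Pi.single j (N : ℤ))) = N := by
      rw [facetHeight, intVecToReal_dotProduct, dotProduct_add, hvF, dotProduct_single]
      push_cast
      field_simp
      ring
    refine ⟨by rw [h0]; positivity, h0.le, ?_⟩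
    rw [h0]
    convert hmemP v hvS using 1
    ext i
    by_cases h : i = j
    · subst h; simp
    · simp [h]
  obtain ⟨B, hBT, hB⟩ := exists_matrix_of_span_eq_top
    (insert (Pi.single j (N : ℤ)) {y | v + y ∈ S ∧ F.1 ⬝ᵥ (v + y) = F.2}) (by
      rw [eq_top_iff]
      intro x _
      set s := Submodule.span ℚ (intVecToRat d '' insert (Pi.single j (N : ℤ))
        {y | v + y ∈ S ∧ F.1 ⬝ᵥ (v + y) = F.2}) with hs
      have h1 : intVecToRat d (Pi.single j (N : ℤ)) ∈ s :=
        Submodule.subset_span ⟨_, Set.mem_insert _ _, rfl⟩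
      have hjQ : (F.1 j : ℚ) ≠ 0 := by exact_mod_cast hj
      have hNQ : (N : ℚ) ≠ 0 := by exact_mod_cast (by omega : N ≠ 0)
      set c : ℚ := (intVecToRat d F.1 ⬝ᵥ x) / (N * F.1 j)
      have h2 : x - c • intVecToRat d (Pi.single j (N : ℤ)) ∈ s := by
        refine Submodule.span_mono (Set.image_mono (Set.subset_insert _ _)) (hspan _ ?_)
        have : intVecToRat d (Pi.single j (N : ℤ)) = Pi.single j (N : ℚ) := by
          ext i
          by_cases h : i = j
          · subst h; simp
          · simp [h]
        rw [this, dotProduct_sub, dotProduct_smul, dotProduct_single, intVecToRat_apply,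
          smul_eq_mul]
        simp only [c]
        field_simp
        ring
      simpa using Submodule.add_mem _ h2 (Submodule.smul_mem _ c h1))
  have hfin : volume (facetPrism (N : ℝ) 𝓕 j F) ≠ ⊤ :=
    ((measure_mono (facetPrism_subset_Icc (by positivity))).trans_lt
      isCompact_Icc.measure_lt_top).ne
  have := card_mul_index_le_volume (facetPrism (N : ℝ) 𝓕 j F) convex_facetPrism hfin Λ v B hB
    (fun i => ?_) (hmem v hvS hvF) (fun i => ?_) (S.filter fun p => F.1 ⬝ᵥ p = F.2)
    (fun x hx => hmem x (Finset.mem_filter.1 hx).1 (Finset.mem_filter.1 hx).2) (fun x hx => ?_)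
  · rwa [hΛi] at this
  · show φ (B i) ∈ AddSubgroup.zmultiples ((N : ℤ) * F.1 j)
    rw [hφ]
    rcases hBT i with h | h
    · rw [h, dotProduct_single, mul_comm]
      exact AddSubgroup.mem_zmultiples _
    · have := h.2
      rw [dotProduct_add, hvF, add_eq_left] at this
      rw [this]
      exact zero_mem _
  · rcases hBT i with h | h
    · rw [h]; exact hmemj
    · exact hmem _ h.1 h.2
  · show φ (x - v) ∈ AddSubgroup.zmultiples ((N : ℤ) * F.1 j)
    rw [hφ, dotProduct_sub, hvF, (Finset.mem_filter.1 hx).2, sub_self]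
    exact zero_mem _

theorem sum_card_mul_le_of_sign {d : ℕ} {N : ℕ} (hN : 1 ≤ N) {S : Finset (Fin d → ℤ)}
    {𝓕 : Finset ((Fin d → ℤ) × ℤ)} {j : Fin d}
    (hS : ∀ p ∈ S, ∀ i, 0 ≤ p i ∧ p i ≤ N) (h𝓕 : ∀ F ∈ 𝓕, IsLatticeFacet S F)
    (hsign : ∀ F ∈ 𝓕, ∀ G ∈ 𝓕, 0 < F.1 j * G.1 j) :
    ∑ F ∈ 𝓕, ((S.filter fun p => F.1 ⬝ᵥ p = F.2).card : ℝ) * (N * |(F.1 j : ℝ)|) ≤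
      ((d : ℝ) + 1) ^ d * (2 * N) ^ d := by
  have hle : ∀ G ∈ 𝓕, ∀ p ∈ S, G.2 ≤ G.1 ⬝ᵥ p := fun G hG => (h𝓕 G hG).le
  have hfin : volume (Set.Icc (0 : Fin d → ℝ) fun _ => 2 * (N : ℝ)) ≠ ⊤ :=
    isCompact_Icc.measure_lt_top.ne
  have hsub : ∀ F ∈ 𝓕, facetPrism (N : ℝ) 𝓕 j F ⊆ Set.Icc (0 : Fin d → ℝ) fun _ => 2 * (N : ℝ) :=
    fun F _ => facetPrism_subset_Icc (by positivity)
  have hdisj : (𝓕 : Set ((Fin d → ℤ) × ℤ)).Pairwise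
      (Function.onFun (AEDisjoint volume) (facetPrism (N : ℝ) 𝓕 j)) := by
    intro F hF G hG hFG
    refine aedisjoint_facetPrism hF hG (hsign F hF G hG) fun hpar => hFG ?_
    obtain ⟨u, hu⟩ := (h𝓕 F hF).primitive
    obtain ⟨u', hu'⟩ := (h𝓕 G hG).primitive
    -- Parallel primitive normals with `j`-th entries of the same sign coincide, and then so do the
    -- bounds, both being attained on `S`.
    have e1 : G.1 j = F.1 j * (G.1 ⬝ᵥ u) := by
      have := congrArg (· ⬝ᵥ u) hpar
      simpa only [smul_dotProduct, hu, smul_eq_mul, mul_one] using this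
    have e2 : F.1 j = G.1 j * (F.1 ⬝ᵥ u') := by
      have := congrArg (· ⬝ᵥ u') hpar
      simpa only [smul_dotProduct, hu', smul_eq_mul, mul_one] using this.symm
    have hs := hsign F hF G hG
    have hnat := Int.natAbs_eq_natAbs_iff.1
      (Int.natAbs_eq_of_dvd_dvd (Dvd.intro _ e1.symm) (Dvd.intro _ e2.symm))
    have hj : F.1 j = G.1 j := by
      rcases hnat with h | h
      · exact h
      · rw [h] at hs
        nlinarith [sq_nonneg (G.1 j)]
    have hj0 : G.1 j ≠ 0 := fun h => by simp [h] at hs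
    have hn : F.1 = G.1 := by
      rw [hj] at hpar
      exact smul_right_injective _ hj0 hpar
    refine Prod.ext hn ?_
    obtain ⟨v, hv, hvF, -⟩ := (h𝓕 F hF).spans
    obtain ⟨v', hv', hvG, -⟩ := (h𝓕 G hG).spans
    refine le_antisymm ?_ ?_
    · rw [← hvG, ← hn]; exact (h𝓕 F hF).le v' hv'
    · rw [← hvF, hn]; exact (h𝓕 G hG).le v hv
  calc _ ≤ ∑ F ∈ 𝓕, ((d : ℝ) + 1) ^ d * volume.real (facetPrism (N : ℝ) 𝓕 j F) := by
        refine Finset.sum_le_sum fun F hF => (h𝓕 F hF).card_mul_le hN hS hle fun h => ?_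
        have := hsign F hF F hF
        simp [h] at this
    _ = ((d : ℝ) + 1) ^ d * volume.real (⋃ F ∈ 𝓕, facetPrism (N : ℝ) 𝓕 j F) := by
        rw [← Finset.mul_sum, measureReal_biUnion_finset₀ hdisj
          (fun F _ => isClosed_facetPrism.measurableSet.nullMeasurableSet)
          (fun F hF => ((measure_mono (hsub F hF)).trans_lt hfin.lt_top).ne)]
    _ ≤ ((d : ℝ) + 1) ^ d * volume.real (Set.Icc (0 : Fin d → ℝ) fun _ => 2 * (N : ℝ)) := by
        gcongr
        exact Set.iUnion₂_subset hsub
    _ = _ := by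
        congr 1
        rw [Measure.real, Real.volume_Icc_pi_toReal (fun _ => by positivity)]
        simp

theorem sum_card_mul_le {d : ℕ} {N : ℕ} (hN : 1 ≤ N) {S : Finset (Fin d → ℤ)}
    {𝓕 : Finset ((Fin d → ℤ) × ℤ)} (j : Fin d)
    (hS : ∀ p ∈ S, ∀ i, 0 ≤ p i ∧ p i ≤ N) (h𝓕 : ∀ F ∈ 𝓕, IsLatticeFacet S F) :
    ∑ F ∈ 𝓕, ((S.filter fun p => F.1 ⬝ᵥ p = F.2).card : ℝ) * (N * |(F.1 j : ℝ)|) ≤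
      2 * (((d : ℝ) + 1) ^ d * (2 * N) ^ d) := by
  classical
  have h1 := sum_card_mul_le_of_sign (𝓕 := 𝓕.filter fun F => 0 < F.1 j) (j := j) hN hS
    (fun F hF => h𝓕 F (Finset.mem_filter.1 hF).1)
    (fun F hF G hG => mul_pos (Finset.mem_filter.1 hF).2 (Finset.mem_filter.1 hG).2)
  have h2 := sum_card_mul_le_of_sign (𝓕 := 𝓕.filter fun F => F.1 j < 0) (j := j) hN hS
    (fun F hF => h𝓕 F (Finset.mem_filter.1 hF).1)
    (fun F hF G hG => mul_pos_of_neg_of_neg (Finset.mem_filter.1 hF).2 (Finset.mem_filter.1 hG).2)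
  rw [Finset.sum_filter] at h1 h2
  rw [two_mul]
  refine le_trans ?_ (add_le_add h1 h2)
  rw [← Finset.sum_add_distrib]
  refine Finset.sum_le_sum fun F _ => ?_
  rcases lt_trichotomy (F.1 j) 0 with h | h | h
  · simp [h, h.not_gt]
  · simp [h]
  · simp [h, h.not_gt]

theorem exists_pos_smul_eq_primitive {d : ℕ} (y : Fin d → ℚ) (hy : y ≠ 0) :
    ∃ c : ℚ, 0 < c ∧ ∃ n : Fin d → ℤ, c • y = intVecToRat d n ∧ ∃ u, n ⬝ᵥ u = 1 := by
  classical
  set D : ℕ := ∏ i, (y i).den with hD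
  have hD0 : 0 < D := Finset.prod_pos fun i _ => (y i).den_pos
  have hm : ∀ i, ∃ k : ℤ, (D : ℚ) * y i = k := fun i => by
    obtain ⟨k, hk⟩ : (y i).den ∣ D := Finset.dvd_prod_of_mem _ (Finset.mem_univ i)
    refine ⟨k * (y i).num, ?_⟩
    rw [hk]
    push_cast
    rw [mul_comm ((y i).den : ℚ), mul_assoc, Rat.den_mul_eq_num]
  choose m hm using hm
  have hm0 : m ≠ 0 := by
    rintro rfl
    apply hy
    funext i
    have := hm i
    simpa [hD0.ne'] using this
  -- The generator of this ideal is a gcd of the entries of `m`, and a preimage of it supplies the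
  -- Bézout coefficients that witness primitivity.
  let I : Ideal ℤ := LinearMap.range (dotProductBilin ℤ ℤ m)
  obtain ⟨g, hg⟩ := (IsPrincipalIdealRing.principal I).principal
  have hgI : g ∈ I := by rw [hg]; exact Submodule.mem_span_singleton_self g
  obtain ⟨u, hu⟩ := hgI
  have hu' : m ⬝ᵥ u = g := hu
  have hdvd : ∀ i, ∃ k, m i = g * k := fun i => by
    have h1 : m i ∈ I := ⟨Pi.single i 1, by simp⟩
    rw [hg] at h1
    obtain ⟨k, hk⟩ := Submodule.mem_span_singleton.1 h1
    exact ⟨k, by rw [← hk, smul_eq_mul, mul_comm]⟩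
  choose n hn using hdvd
  have hmn : m = g • n := funext hn
  have hg0 : g ≠ 0 := fun h => hm0 (by rw [hmn, h, zero_smul])
  have hnu : n ⬝ᵥ u = 1 := by
    rw [hmn, smul_dotProduct, smul_eq_mul] at hu'
    exact mul_left_cancel₀ hg0 (by rw [hu', mul_one])
  have hgQ : (g : ℚ) ≠ 0 := by exact_mod_cast hg0
  have key : ∀ i, (D : ℚ) * y i = g * n i := fun i => by rw [hm, hn]; push_cast; ring
  rcases hg0.lt_or_gt with hneg | hpos
  · have hnegQ : (g : ℚ) < 0 := by exact_mod_cast hneg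
    refine ⟨D / -g, div_pos (by exact_mod_cast hD0) (neg_pos.2 hnegQ), -n, ?_, -u, by simpa using hnu⟩
    funext i
    have := key i
    simp only [Pi.smul_apply, smul_eq_mul, intVecToRat_apply, Pi.neg_apply]
    push_cast
    field_simp
    linarith
  · have hposQ : (0 : ℚ) < g := by exact_mod_cast hpos
    refine ⟨D / g, div_pos (by exact_mod_cast hD0) hposQ, n, ?_, u, hnu⟩
    funext i
    have := key i
    simp only [Pi.smul_apply, smul_eq_mul, intVecToRat_apply]
    field_simp
    linarith

theorem intVecToRat_dotProduct {d : ℕ} (x y : Fin d → ℤ) :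
    intVecToRat d x ⬝ᵥ intVecToRat d y = ((x ⬝ᵥ y : ℤ) : ℚ) := by
  simp [dotProduct]

/-- Facet normals at `v` are, up to positive scaling, the extremal functionals of the cone generated
by `S - v`. The weight `w` makes this cone pointed, so they span the dual space. -/
theorem exists_facet_matrix {d : ℕ} (S : Finset (Fin d → ℤ)) (v : Fin d → ℤ) (hv : v ∈ S)
    (hspan : Submodule.span ℚ ((fun p => intVecToRat d (p - v)) '' (S : Set (Fin d → ℤ))) = ⊤)
    (w : Fin d → ℚ) (hw : ∀ p ∈ S, p ≠ v → 0 < w ⬝ᵥ intVecToRat d (p - v)) :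
    ∃ B : Matrix (Fin d) (Fin d) ℤ, (∀ i, IsLatticeFacet S (B i, B i ⬝ᵥ v)) ∧ B.det ≠ 0 := by
  classical
  refine exists_matrix_of_span_eq_top {n | IsLatticeFacet S (n, n ⬝ᵥ v)} ?_
  set A : Finset (Fin d → ℚ) := S.image fun p => intVecToRat d (p - v) with hA
  have hext := span_extremalFunctionals (K := ℚ) A (by rw [hA, Finset.coe_image]; exact hspan)
    (dotProductEquiv ℚ (Fin d) w) (by
      intro a ha ha0
      obtain ⟨p, hp, rfl⟩ := Finset.mem_image.1 ha
      exact hw p hp (by rintro rfl; simp at ha0))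
  set s := Submodule.span ℚ (intVecToRat d '' {n | IsLatticeFacet S (n, n ⬝ᵥ v)}) with hs
  have hsub : extremalFunctionals (K := ℚ) A ⊆
      s.map (dotProductEquiv ℚ (Fin d) : (Fin d → ℚ) →ₗ[ℚ] Dual ℚ (Fin d → ℚ)) := by
    rintro e ⟨he1, he2, he3⟩
    obtain ⟨y, rfl⟩ := (dotProductEquiv ℚ (Fin d)).surjective e
    have hy : y ≠ 0 := by rintro rfl; simp at he2
    obtain ⟨c, hc, n, hn, hu⟩ := exists_pos_smul_eq_primitive y hy
    refine ⟨y, ?_, rfl⟩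
    have hdot : ∀ x, intVecToRat d n ⬝ᵥ x = c * (y ⬝ᵥ x) := fun x => by
      rw [← hn, smul_dotProduct, smul_eq_mul]
    have hnT : IsLatticeFacet S (n, n ⬝ᵥ v) := by
      refine ⟨fun p hp => ?_, hu, v, hv, rfl, fun x hx => ?_⟩
      · have h1 : 0 ≤ y ⬝ᵥ intVecToRat d (p - v) := he1 _ (Finset.mem_image_of_mem _ hp)
        have h2 := mul_nonneg hc.le h1
        rw [← hdot, intVecToRat_dotProduct, dotProduct_sub] at h2
        have h3 : (0 : ℤ) ≤ n ⬝ᵥ p - n ⬝ᵥ v := by exact_mod_cast h2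
        exact sub_nonneg.1 h3
      · have h1 : y ⬝ᵥ x = 0 := by
          rw [hdot] at hx
          exact (mul_eq_zero.1 hx).resolve_left hc.ne'
        refine Submodule.span_mono ?_ (he3 x h1)
        rintro a ⟨ha, hea⟩
        obtain ⟨p, hp, rfl⟩ := Finset.mem_image.1 ha
        have h2 : y ⬝ᵥ intVecToRat d (p - v) = 0 := hea
        refine ⟨p - v, ⟨by simpa using hp, ?_⟩, rfl⟩
        have h3 := hdot (intVecToRat d (p - v))
        rw [h2, mul_zero, intVecToRat_dotProduct, dotProduct_sub] at h3
        have h4 : n ⬝ᵥ p - n ⬝ᵥ v = 0 := by exact_mod_cast h3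
        simp only [add_sub_cancel]
        linarith
    have h1 : intVecToRat d n ∈ s := Submodule.subset_span ⟨n, hnT, rfl⟩
    rw [← hn] at h1
    exact (Submodule.smul_mem_iff _ hc.ne').1 h1
  rw [eq_top_iff]
  intro y _
  have h1 : dotProductEquiv ℚ (Fin d) y ∈
      s.map (dotProductEquiv ℚ (Fin d) : (Fin d → ℚ) →ₗ[ℚ] Dual ℚ (Fin d → ℚ)) := by
    apply Submodule.span_le.2 hsub
    rw [hext]
    trivial
  obtain ⟨z, hz, hzy⟩ := h1
  rwa [← (dotProductEquiv ℚ (Fin d)).injective hzy]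

/-! ### Packing the normal cones and counting vertices -/

/-- The sum of the absolute values of the entries of a matrix. -/
def entrySum {d : ℕ} (B : Matrix (Fin d) (Fin d) ℤ) : ℝ := ∑ i, ∑ j, |(B i j : ℝ)|

theorem entrySum_pos {d : ℕ} (hd : 1 ≤ d) (B : Matrix (Fin d) (Fin d) ℤ) (hB : B.det ≠ 0) :
    0 < entrySum B := by
  have hnn : 0 ≤ entrySum B := by unfold entrySum; positivity
  refine lt_of_le_of_ne hnn fun h => hB ?_
  apply Matrix.det_eq_zero_of_row_eq_zero (⟨0, hd⟩ : Fin d)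
  intro j
  have h1 := (Finset.sum_eq_zero_iff_of_nonneg (fun i _ => by positivity)).1 h.symm ⟨0, hd⟩
    (Finset.mem_univ _)
  have h2 := (Finset.sum_eq_zero_iff_of_nonneg (fun i _ => by positivity)).1 h1 j
    (Finset.mem_univ _)
  simpa using h2

/-- The parallelepiped spanned by the rows of `B`, scaled into the cube `[-1,1]^d`. -/
noncomputable def scaledParallelepiped {d : ℕ} (B : Matrix (Fin d) (Fin d) ℤ) :
    Set (Fin d → ℝ) :=
  (B.map (Int.castRingHom ℝ)).transpose.toLin' '' Set.Icc 0 fun _ => (entrySum B)⁻¹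

theorem isCompact_scaledParallelepiped {d : ℕ} (B : Matrix (Fin d) (Fin d) ℤ) :
    IsCompact (scaledParallelepiped B) :=
  isCompact_Icc.image (LinearMap.continuous_of_finiteDimensional _)

/-- A nonzero integer determinant has absolute value at least one, so the linear map does not shrink
the volume of the small cube. -/
theorem le_volume_scaledParallelepiped {d : ℕ} (hd : 1 ≤ d) (B : Matrix (Fin d) (Fin d) ℤ)
    (hB : B.det ≠ 0) : (entrySum B ^ d)⁻¹ ≤ volume.real (scaledParallelepiped B) := by
  have hpos := entrySum_pos hd B hB
  have hdet : (B.map (Int.castRingHom ℝ)).transpose.det = (B.det : ℝ) := by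
    rw [Matrix.det_transpose]
    exact (RingHom.map_det (Int.castRingHom ℝ) B).symm
  rw [Measure.real, scaledParallelepiped, Measure.addHaar_image_linearMap, LinearMap.det_toLin',
    hdet, ENNReal.toReal_mul, ENNReal.toReal_ofReal (abs_nonneg _),
    Real.volume_Icc_pi_toReal (fun _ => by positivity)]
  have h1 : (1 : ℝ) ≤ |(B.det : ℝ)| := by exact_mod_cast Int.one_le_abs hB
  simp only [Pi.zero_apply, sub_zero, Finset.prod_const, Finset.card_univ, Fintype.card_fin,
    inv_pow]
  exact le_mul_of_one_le_left (by positivity) h1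

theorem scaledParallelepiped_subset {d : ℕ} (hd : 1 ≤ d) (B : Matrix (Fin d) (Fin d) ℤ)
    (hB : B.det ≠ 0) : scaledParallelepiped B ⊆ Set.Icc (fun _ => -1) (fun _ => 1) := by
  have hpos := entrySum_pos hd B hB
  rintro _ ⟨t, ht, rfl⟩
  have key : ∀ j, |∑ i, (B i j : ℝ) * t i| ≤ 1 := fun j => by
    calc |∑ i, (B i j : ℝ) * t i| ≤ ∑ i, |(B i j : ℝ) * t i| := Finset.abs_sum_le_sum_abs _ _
      _ ≤ ∑ i, (∑ j, |(B i j : ℝ)|) * (entrySum B)⁻¹ := by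
          refine Finset.sum_le_sum fun i _ => ?_
          rw [abs_mul, abs_of_nonneg (ht.1 i)]
          refine mul_le_mul ?_ (ht.2 i) (ht.1 i) (by positivity)
          exact Finset.single_le_sum (f := fun j => |(B i j : ℝ)|) (fun _ _ => by positivity)
            (Finset.mem_univ j)
      _ = 1 := by
          rw [← Finset.sum_mul]
          exact mul_inv_cancel₀ hpos.ne'
  have hcoord : ∀ j, (B.map (Int.castRingHom ℝ)).transpose.toLin' t j = ∑ i, (B i j : ℝ) * t i := fun j => by
    simp [Matrix.mulVec, dotProduct]
  exact ⟨fun j => by rw [hcoord]; exact (abs_le.1 (key j)).1,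
    fun j => by rw [hcoord]; exact (abs_le.1 (key j)).2⟩

theorem dotProduct_nonneg_of_mem_scaledParallelepiped {d : ℕ} {B : Matrix (Fin d) (Fin d) ℤ}
    {x : Fin d → ℤ} (hx : ∀ i, 0 ≤ B i ⬝ᵥ x) {z : Fin d → ℝ} (hz : z ∈ scaledParallelepiped B) :
    0 ≤ intVecToReal d x ⬝ᵥ z := by
  obtain ⟨t, ht, rfl⟩ := hz
  rw [Matrix.toLin'_apply, Matrix.dotProduct_mulVec, Matrix.vecMul_transpose]
  refine Finset.sum_nonneg fun i _ => mul_nonneg ?_ (ht.1 i)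
  have h1 : (Matrix.mulVec (B.map (Int.castRingHom ℝ)) (intVecToReal d x)) i =
      ((B i ⬝ᵥ x : ℤ) : ℝ) := by
    simp [Matrix.mulVec, dotProduct]
  rw [h1]
  exact_mod_cast hx i

/-- The parallelepiped of `v` consists of functionals minimized on `V` at `v`. A functional common
to those of `v` and `v'` vanishes on `v' - v`, so the overlaps are null. -/
theorem sum_inv_entrySum_pow_le {d : ℕ} (hd : 1 ≤ d) (V : Finset (Fin d → ℤ))
    (B : (Fin d → ℤ) → Matrix (Fin d) (Fin d) ℤ) (hB : ∀ v ∈ V, (B v).det ≠ 0)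
    (hmin : ∀ v ∈ V, ∀ p ∈ V, ∀ i, B v i ⬝ᵥ v ≤ B v i ⬝ᵥ p) :
    ∑ v ∈ V, (entrySum (B v) ^ d)⁻¹ ≤ 2 ^ d := by
  have hfin : volume (Set.Icc (fun _ : Fin d => (-1 : ℝ)) (fun _ => 1)) ≠ ⊤ :=
    isCompact_Icc.measure_lt_top.ne
  have hdisj : (V : Set (Fin d → ℤ)).Pairwise
      (Function.onFun (AEDisjoint volume) fun v => scaledParallelepiped (B v)) := by
    intro v hv v' hv' hne
    have hne' : intVecToReal d (v' - v) ≠ 0 := by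
      intro h
      apply hne
      funext i
      have := congrFun h i
      rw [intVecToReal_apply, Pi.zero_apply] at this
      have h2 : (v' - v) i = 0 := by exact_mod_cast this
      rw [Pi.sub_apply] at h2
      linarith
    refine measure_mono_null (fun z hz => ?_) (volume_affine_hyperplane _ hne' 0)
    have h1 := dotProduct_nonneg_of_mem_scaledParallelepiped (x := v' - v)
      (fun i => by rw [dotProduct_sub]; linarith [hmin v hv v' hv' i]) hz.1
    have h2 := dotProduct_nonneg_of_mem_scaledParallelepiped (x := v - v')
      (fun i => by rw [dotProduct_sub]; linarith [hmin v' hv' v hv i]) hz.2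
    rw [← neg_sub v' v, map_neg, neg_dotProduct] at h2
    show intVecToReal d (v' - v) ⬝ᵥ z = 0
    linarith
  calc ∑ v ∈ V, (entrySum (B v) ^ d)⁻¹ ≤ ∑ v ∈ V, volume.real (scaledParallelepiped (B v)) :=
        Finset.sum_le_sum fun v hv => le_volume_scaledParallelepiped hd _ (hB v hv)
    _ = volume.real (⋃ v ∈ V, scaledParallelepiped (B v)) := by
        rw [measureReal_biUnion_finset₀ hdisj
          (fun v _ => (isCompact_scaledParallelepiped _).measurableSet.nullMeasurableSet)
          (fun v _ => (isCompact_scaledParallelepiped _).measure_lt_top.ne)]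
    _ ≤ volume.real (Set.Icc (fun _ : Fin d => (-1 : ℝ)) (fun _ => 1)) :=
        measureReal_mono
          (Set.iUnion₂_subset fun v hv => scaledParallelepiped_subset hd _ (hB v hv)) hfin
    _ = 2 ^ d := by
        rw [Measure.real, Real.volume_Icc_pi_toReal (fun _ => by norm_num)]
        norm_num

/-- A facet is used by at most as many vertices as it has points of `S`, which is the multiplicity
allowed in `sum_card_mul_le`. -/
theorem sum_entrySum_le {d : ℕ} {N : ℕ} (hN : 1 ≤ N) (S V : Finset (Fin d → ℤ)) (hVS : V ⊆ S)
    (hS : ∀ p ∈ S, ∀ i, 0 ≤ p i ∧ p i ≤ N)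
    (B : (Fin d → ℤ) → Matrix (Fin d) (Fin d) ℤ) (hB : ∀ v ∈ V, (B v).det ≠ 0)
    (hfacet : ∀ v ∈ V, ∀ i, IsLatticeFacet S (B v i, B v i ⬝ᵥ v)) :
    N * ∑ v ∈ V, entrySum (B v) ≤ d * (2 * (((d : ℝ) + 1) ^ d * (2 * N) ^ d)) := by
  classical
  let f : (Fin d → ℤ) × Fin d → (Fin d → ℤ) × ℤ := fun q => (B q.1 q.2, B q.1 q.2 ⬝ᵥ q.1)
  set 𝓕 := (V ×ˢ (Finset.univ : Finset (Fin d))).image f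
  have h𝓕 : ∀ F ∈ 𝓕, IsLatticeFacet S F := fun F hF => by
    obtain ⟨q, hq, rfl⟩ := Finset.mem_image.1 hF
    exact hfacet _ (Finset.mem_product.1 hq).1 _
  have key : ∀ j : Fin d, ∑ v ∈ V, ∑ i, N * |(B v i j : ℝ)| ≤
      2 * (((d : ℝ) + 1) ^ d * (2 * N) ^ d) := fun j => by
    refine le_trans ?_ (sum_card_mul_le hN j hS h𝓕)
    rw [← Finset.sum_product' V Finset.univ fun v i => (N : ℝ) * |(B v i j : ℝ)|]
    have h1 := Finset.sum_comp (s := V ×ˢ (Finset.univ : Finset (Fin d)))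
      (fun F : (Fin d → ℤ) × ℤ => (N : ℝ) * |(F.1 j : ℝ)|) f
    refine h1.le.trans ?_
    refine Finset.sum_le_sum fun F _ => ?_
    rw [nsmul_eq_mul]
    refine mul_le_mul_of_nonneg_right ?_ (by positivity)
    -- A vertex uses a given facet in only one row, since two equal rows would make the determinant
    -- vanish.
    refine Nat.cast_le.2 (Finset.card_le_card_of_injOn Prod.fst ?_ ?_)
    · intro q hq
      simp only [Finset.coe_filter, Finset.mem_product, Finset.mem_univ, and_true,
        Set.mem_ofPred_eq] at hq ⊢
      exact ⟨hVS hq.1, by rw [← hq.2]⟩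
    · intro q hq q' hq' hqq
      simp only [Finset.coe_filter, Finset.mem_product, Finset.mem_univ, and_true,
        Set.mem_ofPred_eq] at hq hq'
      refine Prod.ext hqq ?_
      by_contra hne
      refine hB q.1 hq.1 (Matrix.det_zero_of_row_eq hne ?_)
      have := congrArg Prod.fst (hq.2.trans hq'.2.symm)
      simp only [f] at this
      rw [this, hqq]
  calc N * ∑ v ∈ V, entrySum (B v) = ∑ j : Fin d, ∑ v ∈ V, ∑ i, N * |(B v i j : ℝ)| := by
        rw [Finset.sum_comm, Finset.mul_sum]
        refine Finset.sum_congr rfl fun v _ => ?_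
        rw [Finset.sum_comm, entrySum, Finset.mul_sum]
        simp_rw [Finset.mul_sum]
    _ ≤ ∑ _j : Fin d, 2 * (((d : ℝ) + 1) ^ d * (2 * N) ^ d) := Finset.sum_le_sum fun j _ => key j
    _ = _ := by simp

theorem one_le_add_inv_pow {d : ℕ} {x : ℝ} (hx : 0 < x) : 1 ≤ x + (x ^ d)⁻¹ := by
  rcases le_total 1 x with h | h
  · have : 0 ≤ (x ^ d)⁻¹ := by positivity
    linarith
  · have := (one_le_inv₀ (pow_pos hx d)).2 (pow_le_one₀ hx.le h)
    linarith

theorem card_le_of_facet_matrices {d : ℕ} (hd : 1 ≤ d) {N : ℕ} (hN : 1 ≤ N)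
    (S V : Finset (Fin d → ℤ)) (hVS : V ⊆ S) (hS : ∀ p ∈ S, ∀ i, 0 ≤ p i ∧ p i ≤ N)
    (B : (Fin d → ℤ) → Matrix (Fin d) (Fin d) ℤ) (hB : ∀ v ∈ V, (B v).det ≠ 0)
    (hfacet : ∀ v ∈ V, ∀ i, IsLatticeFacet S (B v i, B v i ⬝ᵥ v)) :
    (V.card : ℝ) ≤ (d * (2 * (((d : ℝ) + 1) ^ d * 2 ^ d)) + 2 ^ d) *
      (N : ℝ) ^ ((d : ℝ) * (((d : ℝ) - 1) / ((d : ℝ) + 1))) := by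
  have hNR : (0 : ℝ) < N := by exact_mod_cast hN
  have hd1 : (d : ℝ) + 1 ≠ 0 := by positivity
  -- This exponent solves `d - 1 - e = d * e`, so that scaling the entry sums by `s = N^(-e)`
  -- balances the two packing bounds.
  set e : ℝ := ((d : ℝ) - 1) / ((d : ℝ) + 1) with he
  set s : ℝ := (N : ℝ) ^ (-e) with hs
  have hs0 : 0 < s := Real.rpow_pos_of_pos hNR _
  have h1 := sum_inv_entrySum_pow_le hd V B hB
    fun v hv p hp i => (hfacet v hv i).le p (hVS hp)
  have h2 := sum_entrySum_le hN S V hVS hS B hB hfacet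
  set c : ℝ := d * (2 * (((d : ℝ) + 1) ^ d * 2 ^ d)) with hc
  have h3 : ∑ v ∈ V, entrySum (B v) ≤ c * (N : ℝ) ^ ((d : ℝ) - 1) := by
    rw [Real.rpow_sub_one hNR.ne', Real.rpow_natCast, ← mul_div_assoc, le_div_iff₀ hNR]
    calc _ = N * ∑ v ∈ V, entrySum (B v) := mul_comm _ _
      _ ≤ _ := h2
      _ = _ := by rw [hc, mul_pow]; ring
  have e1 : s * (N : ℝ) ^ ((d : ℝ) - 1) = (N : ℝ) ^ ((d : ℝ) * e) := by
    rw [hs, ← Real.rpow_add hNR]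
    congr 1
    rw [he]
    field_simp
    ring
  have e2 : (s ^ d)⁻¹ = (N : ℝ) ^ ((d : ℝ) * e) := by
    rw [hs, ← Real.rpow_natCast, ← Real.rpow_mul hNR.le, ← Real.rpow_neg hNR.le]
    congr 1
    ring
  calc (V.card : ℝ) = ∑ v ∈ V, (1 : ℝ) := by simp
    _ ≤ ∑ v ∈ V, (entrySum (B v) * s + ((entrySum (B v) * s) ^ d)⁻¹) :=
        Finset.sum_le_sum fun v hv =>
          one_le_add_inv_pow (mul_pos (entrySum_pos hd _ (hB v hv)) hs0)
    _ = (∑ v ∈ V, entrySum (B v)) * s + (∑ v ∈ V, (entrySum (B v) ^ d)⁻¹) * (s ^ d)⁻¹ := by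
        rw [Finset.sum_add_distrib, Finset.sum_mul, Finset.sum_mul]
        simp_rw [mul_pow, mul_inv]
    _ ≤ (c * (N : ℝ) ^ ((d : ℝ) - 1)) * s + 2 ^ d * (s ^ d)⁻¹ := by gcongr
    _ = _ := by rw [mul_assoc, mul_comm _ s, e1, e2]; ring

/-- Andrews' bound on the number of vertices of a lattice polytope, for vertices that minimize a
positive weight. -/
theorem card_le_of_positive_weights (d : ℕ) (hd : 1 ≤ d) :
    ∃ C : ℝ, 0 ≤ C ∧ ∀ (N : ℕ), 1 ≤ N → ∀ V : Finset (Fin d → ℤ),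
      (∀ p ∈ V, ∀ i, 0 ≤ p i ∧ p i ≤ N) →
      (∀ v ∈ V, ∃ w : Fin d → ℚ, (∀ j, 0 < w j) ∧
        ∀ p ∈ V, p ≠ v → 0 < w ⬝ᵥ intVecToRat d (p - v)) →
      (V.card : ℝ) ≤ C * (N : ℝ) ^ ((d : ℝ) * (((d : ℝ) - 1) / ((d : ℝ) + 1))) := by
  classical
  have hdR : (1 : ℝ) ≤ d := by exact_mod_cast hd
  have hexp : 0 ≤ (d : ℝ) * (((d : ℝ) - 1) / ((d : ℝ) + 1)) :=
    mul_nonneg (by positivity) (div_nonneg (by linarith) (by positivity))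
  refine ⟨(d * (2 * (((d : ℝ) + 1) ^ d * 2 ^ d)) + 2 ^ d) *
    2 ^ ((d : ℝ) * (((d : ℝ) - 1) / ((d : ℝ) + 1))), by positivity, ?_⟩
  intro N hN V hV hw
  -- Adding the unit shifts makes `S - v` span the space. Positivity of the weights keeps every `v`
  -- a strict minimizer, and the cube only grows to side `N + 1 ≤ 2 * N`, whence the extra power of
  -- two in the constant.
  set S := V ∪ (V ×ˢ (Finset.univ : Finset (Fin d))).image fun q => q.1 + Pi.single q.2 1 with hSdef
  have hVS : V ⊆ S := Finset.subset_union_left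
  have hmemS : ∀ p, p ∈ S ↔ p ∈ V ∨ ∃ q ∈ V, ∃ j : Fin d, q + Pi.single j 1 = p := by
    intro p
    simp [hSdef]
  have hS : ∀ p ∈ S, ∀ i, 0 ≤ p i ∧ p i ≤ ((N + 1 : ℕ) : ℤ) := by
    intro p hp i
    rcases (hmemS p).1 hp with h | ⟨q, hq, j, rfl⟩
    · have := hV p h i
      push_cast
      exact ⟨this.1, by linarith [this.2]⟩
    · have := hV q hq i
      have h2 : (0 : ℤ) ≤ (Pi.single j 1 : Fin d → ℤ) i ∧ (Pi.single j 1 : Fin d → ℤ) i ≤ 1 := by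
        by_cases h : i = j
        · subst h; simp
        · simp [h]
      rw [Pi.add_apply]
      push_cast
      constructor <;> linarith [this.1, this.2, h2.1, h2.2]
  have hmat : ∀ v, ∃ B : Matrix (Fin d) (Fin d) ℤ, v ∈ V →
      (∀ i, IsLatticeFacet S (B i, B i ⬝ᵥ v)) ∧ B.det ≠ 0 := by
    intro v
    by_cases hv : v ∈ V
    · obtain ⟨w, hw0, hwV⟩ := hw v hv
      obtain ⟨B, hB⟩ := exists_facet_matrix S v (hVS hv) (by
        rw [eq_top_iff, ← (Pi.basisFun ℚ (Fin d)).span_eq]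
        refine Submodule.span_mono ?_
        rintro _ ⟨j, rfl⟩
        refine ⟨v + Pi.single j 1, (hmemS _).2 (Or.inr ⟨v, hv, j, rfl⟩), ?_⟩
        rw [Pi.basisFun_apply]
        ext i
        by_cases h : i = j
        · subst h; simp
        · simp [h]) w (by
        intro p hp hpv
        rcases (hmemS p).1 hp with h | ⟨q, hq, j, rfl⟩
        · exact hwV p h hpv
        · have h1 : intVecToRat d (q + Pi.single j 1 - v) =
              intVecToRat d (q - v) + Pi.single j 1 := by
            ext i
            by_cases h : i = j
            · subst h; simp; ring
            · simp [h]
          rw [h1, dotProduct_add, dotProduct_single, mul_one]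
          by_cases hqv : q = v
          · simpa [hqv] using hw0 j
          · linarith [hwV q hq hqv, hw0 j])
      exact ⟨B, fun _ => hB⟩
    · exact ⟨0, fun h => absurd h hv⟩
  choose B hB using hmat
  have h := card_le_of_facet_matrices hd (N := N + 1) (by omega) S V hVS hS B
    (fun v hv => (hB v hv).2) (fun v hv => (hB v hv).1)
  refine h.trans ?_
  rw [mul_assoc, ← Real.mul_rpow (by norm_num) (by positivity)]
  have hNR : (1 : ℝ) ≤ N := by exact_mod_cast hN
  gcongr
  push_cast
  linarith

end LatticeGeometry

/-! ### Standard monomials and sums of their exponents -/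

namespace HilbertGroebner

open MvPolynomial

open Module (Basis)

variable {F : Type*} [Field F] {d : ℕ}

/-- The exponents of the initial monomials of the nonzero members of `I`. -/
def leadingExponents (m : MonomialOrder (Fin d)) (I : Ideal (MvPolynomial (Fin d) F)) :
    Set (Fin d →₀ ℕ) :=
  {t | ∃ f ∈ I, f ≠ 0 ∧ m.degree f = t}

/-- The exponents of the standard monomials of `I`. -/
def standardExponents (m : MonomialOrder (Fin d)) (I : Ideal (MvPolynomial (Fin d) F)) :
    Set (Fin d →₀ ℕ) :=
  (leadingExponents m I)ᶜ

variable {m : MonomialOrder (Fin d)} {I : Ideal (MvPolynomial (Fin d) F)}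

theorem leadingExponents_upward {s t : Fin d →₀ ℕ} (ht : t ∈ leadingExponents m I) (hts : t ≤ s) :
    s ∈ leadingExponents m I := by
  classical
  obtain ⟨f, hfI, hf0, rfl⟩ := ht
  have h1 : (monomial (s - m.degree f) (1 : F)) ≠ 0 := by simp
  refine ⟨monomial (s - m.degree f) 1 * f, I.mul_mem_left _ hfI, mul_ne_zero h1 hf0, ?_⟩
  rw [m.degree_mul h1 hf0, m.degree_monomial]
  simp [tsub_add_cancel_of_le hts]

theorem standardExponents_downward {s t : Fin d →₀ ℕ} (ht : t ∈ standardExponents m I)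
    (hst : s ≤ t) : s ∈ standardExponents m I :=
  fun hs => ht (leadingExponents_upward hs hst)

theorem eq_zero_of_mem_of_support_subset {f : MvPolynomial (Fin d) F} (hf : f ∈ I)
    (hs : ∀ u ∈ f.support, u ∈ standardExponents m I) : f = 0 := by
  by_contra h
  exact hs _ (m.degree_mem_support h) ⟨f, hf, h, rfl⟩

/-- Reduction modulo `I` by well-founded induction on the order. The bound by `t` on the exponents
is retained because the comparison of standard bases depends on it. -/
theorem monomial_mem_sup_span (t : Fin d →₀ ℕ) :
    (monomial t (1 : F)) ∈ I.restrictScalars F ⊔ Submodule.span F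
      ((fun u => monomial u (1 : F)) '' {u | u ∈ standardExponents m I ∧ m.toSyn u ≤ m.toSyn t}) := by
  induction ht : m.toSyn t using WellFoundedLT.induction generalizing t with
  | _ τ ih =>
    subst ht
    by_cases hstd : t ∈ standardExponents m I
    · exact Submodule.mem_sup_right (Submodule.subset_span ⟨t, ⟨hstd, le_rfl⟩, rfl⟩)
    obtain ⟨g, hgI, hg0, rfl⟩ := not_not.1 hstd
    set W := I.restrictScalars F ⊔ Submodule.span F ((fun u => monomial u (1 : F)) ''
      {u | u ∈ standardExponents m I ∧ m.toSyn u ≤ m.toSyn (m.degree g)}) with hW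
    have hlc : m.leadingCoeff g ≠ 0 := m.leadingCoeff_ne_zero_iff.2 hg0
    set c := (m.leadingCoeff g)⁻¹
    set r := monomial (m.degree g) (1 : F) - c • g with hr
    have hcg : c • g ∈ W := Submodule.mem_sup_left
      (Submodule.smul_mem (I.restrictScalars F) c hgI)
    have hrW : r ∈ W := by
      rw [r.as_sum]
      refine Submodule.sum_mem _ fun u hu => ?_
      have hcoeff : r.coeff u ≠ 0 := mem_support_iff.1 hu
      have hne : u ≠ m.degree g := by
        rintro rfl
        apply hcoeff
        rw [hr, coeff_sub, coeff_smul, coeff_monomial, if_pos rfl, smul_eq_mul]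
        show 1 - c * m.leadingCoeff g = 0
        simp [c, hlc]
      have hgu : u ∈ g.support := by
        rw [mem_support_iff]
        intro h
        apply hcoeff
        rw [hr, coeff_sub, coeff_smul, coeff_monomial, if_neg hne.symm, h]
        simp
      have hlt : m.toSyn u < m.toSyn (m.degree g) :=
        lt_of_le_of_ne (m.le_degree hgu) fun h => hne (m.toSyn.injective h)
      have h1 := ih _ hlt u rfl
      have h2 : monomial u (1 : F) ∈ W := by
        refine (sup_le_sup_left (Submodule.span_mono (Set.image_mono ?_)) (I.restrictScalars F) :
          _ ≤ W) h1
        rintro s ⟨hs1, hs2⟩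
        exact ⟨hs1, hs2.trans hlt.le⟩
      have h3 : monomial u (r.coeff u) = r.coeff u • monomial u (1 : F) := by
        rw [smul_monomial, smul_eq_mul, mul_one]
      rw [h3]
      exact Submodule.smul_mem _ _ h2
    have := Submodule.add_mem _ hrW hcg
    rwa [hr, sub_add_cancel] at this

theorem mk_monomial_mem_span (t : Fin d →₀ ℕ) :
    Ideal.Quotient.mk I (monomial t (1 : F)) ∈ Submodule.span F
      ((fun u => Ideal.Quotient.mk I (monomial u (1 : F))) ''
        {u | u ∈ standardExponents m I ∧ m.toSyn u ≤ m.toSyn t}) := by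
  obtain ⟨a, ha, b, hb, hab⟩ := Submodule.mem_sup.1 (monomial_mem_sup_span (m := m) (I := I) t)
  have h1 : Ideal.Quotient.mk I a = 0 := Ideal.Quotient.eq_zero_iff_mem.2 ha
  rw [← hab, map_add, h1, zero_add]
  have h2 := Submodule.mem_map_of_mem (f := (Ideal.Quotient.mkₐ F I).toLinearMap) hb
  rw [Submodule.map_span, Set.image_image] at h2
  exact h2

theorem linearIndependent_mk_monomial : LinearIndependent F
    fun u : standardExponents m I => Ideal.Quotient.mk I (monomial (u : Fin d →₀ ℕ) (1 : F)) := by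
  classical
  rw [linearIndependent_iff']
  intro s g hg i hi
  set p : MvPolynomial (Fin d) F := ∑ u ∈ s, monomial (u : Fin d →₀ ℕ) (g u) with hp
  have hcoeff : ∀ v, p.coeff v = ∑ u ∈ s, if (u : Fin d →₀ ℕ) = v then g u else 0 := fun v => by
    rw [hp, coeff_sum]
    simp_rw [coeff_monomial]
  have hpI : p ∈ I := by
    rw [← Ideal.Quotient.eq_zero_iff_mem, hp, map_sum, ← hg]
    refine Finset.sum_congr rfl fun u _ => ?_
    have : monomial (u : Fin d →₀ ℕ) (g u) = g u • monomial (u : Fin d →₀ ℕ) (1 : F) := by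
      rw [smul_monomial, smul_eq_mul, mul_one]
    rw [this]
    rfl
  have hp0 : p = 0 := eq_zero_of_mem_of_support_subset (m := m) hpI fun v hv => by
    rw [mem_support_iff, hcoeff] at hv
    obtain ⟨u, _, hu⟩ := Finset.exists_ne_zero_of_sum_ne_zero hv
    have : (u : Fin d →₀ ℕ) = v := by
      by_contra h
      simp [h] at hu
    rw [← this]
    exact u.2
  have h1 := hcoeff i
  rw [hp0, coeff_zero, Finset.sum_eq_single_of_mem i hi (fun u _ hu => by
    simp [Subtype.coe_injective.ne hu])] at h1
  simpa using h1.symm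

/-- The standard monomials form a basis of the quotient. -/
noncomputable def standardBasis (m : MonomialOrder (Fin d)) (I : Ideal (MvPolynomial (Fin d) F)) :
    Basis (standardExponents m I) F (MvPolynomial (Fin d) F ⧸ I) :=
  Basis.mk (linearIndependent_mk_monomial (m := m) (I := I)) (by
    intro x _
    obtain ⟨p, rfl⟩ := Ideal.Quotient.mk_surjective x
    rw [p.as_sum, map_sum]
    refine Submodule.sum_mem _ fun u _ => ?_
    have : monomial u (p.coeff u) = p.coeff u • monomial u (1 : F) := by
      rw [smul_monomial, smul_eq_mul, mul_one]
    rw [this]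
    refine Submodule.smul_mem _ (p.coeff u) (Submodule.span_mono ?_ (mk_monomial_mem_span (m := m) u))
    rintro _ ⟨s, hs, rfl⟩
    exact ⟨⟨s, hs.1⟩, rfl⟩)

theorem standardBasis_apply (u : standardExponents m I) :
    standardBasis m I u = Ideal.Quotient.mk I (monomial (u : Fin d →₀ ℕ) (1 : F)) := by
  simp [standardBasis]

theorem standardBasis_repr_ne_zero {t : Fin d →₀ ℕ} {u : standardExponents m I}
    (h : (standardBasis m I).repr (Ideal.Quotient.mk I (monomial t (1 : F))) u ≠ 0) :
    m.toSyn u ≤ m.toSyn t := by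
  have h1 : Ideal.Quotient.mk I (monomial t (1 : F)) ∈ Submodule.span F
      (standardBasis m I '' {u | m.toSyn (u : Fin d →₀ ℕ) ≤ m.toSyn t}) := by
    refine Submodule.span_mono ?_ (mk_monomial_mem_span (m := m) t)
    rintro _ ⟨s, hs, rfl⟩
    exact ⟨⟨s, hs.1⟩, hs.2, standardBasis_apply _⟩
  exact (Basis.mem_span_image _).1 h1 (Finsupp.mem_support_iff.2 h)

section Length

variable {n : ℕ} (hI : I ∈ Hilb F n d)

include hI in
theorem finite_quotient_of_mem_Hilb : Module.Finite F (MvPolynomial (Fin d) F ⧸ I) := by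
  rw [← Module.rank_lt_aleph0_iff]
  rw [show Module.rank F (MvPolynomial (Fin d) F ⧸ I) = n from hI]
  exact Cardinal.natCast_lt_aleph0

include hI in
theorem finite_standardExponents (m : MonomialOrder (Fin d)) : Finite (standardExponents m I) :=
  have := finite_quotient_of_mem_Hilb hI
  Module.Finite.finite_basis (standardBasis m I)

include hI in
theorem card_standardExponents (m : MonomialOrder (Fin d)) :
    Nat.card (standardExponents m I) = n := by
  rw [← Module.finrank_eq_nat_card_basis (standardBasis m I)]
  exact Module.finrank_eq_of_rank_eq hI

include hI in
-- The base change between the two standard bases is invertible, so some term of its Leibniz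
-- expansion is nonzero. Its permutation pairs each `m'`-standard monomial with an `m`-standard one
-- occurring in its reduction, hence no larger for `m`.
theorem exists_equiv_toSyn_le (m m' : MonomialOrder (Fin d)) :
    ∃ φ : standardExponents m' I ≃ standardExponents m I,
      ∀ t, m.toSyn (φ t : Fin d →₀ ℕ) ≤ m.toSyn (t : Fin d →₀ ℕ) := by
  classical
  have := finite_standardExponents hI m
  have := finite_standardExponents hI m'
  have := Fintype.ofFinite (standardExponents m I)
  have e : standardExponents m' I ≃ standardExponents m I := (Finite.equivFinOfCardEq
    (card_standardExponents hI m')).trans (Finite.equivFinOfCardEq (card_standardExponents hI m)).symm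
  let b := standardBasis m I
  let b' := (standardBasis m' I).reindex e
  have hdet : b.det b' ≠ 0 := (b.isUnit_det b').ne_zero
  rw [Basis.det_apply, Matrix.det_apply] at hdet
  obtain ⟨σ, _, hσ⟩ := Finset.exists_ne_zero_of_sum_ne_zero hdet
  refine ⟨e.trans σ, fun t => ?_⟩
  have h1 : b.toMatrix b' (σ (e t)) (e t) ≠ 0 := by
    intro h
    apply hσ
    have h2 : ∏ i, b.toMatrix b' (σ i) i = 0 := Finset.prod_eq_zero (Finset.mem_univ (e t)) h
    exact (congrArg _ h2).trans (smul_zero _)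
  rw [Basis.toMatrix_apply] at h1
  apply standardBasis_repr_ne_zero (u := σ (e t))
  convert h1 using 3
  simp [b', standardBasis_apply]

/-- The sum of the exponents of the standard monomials. -/
noncomputable def exponentSum (m : MonomialOrder (Fin d)) (I : Ideal (MvPolynomial (Fin d) F)) :
    Fin d →₀ ℕ :=
  ∑ᶠ u : standardExponents m I, (u : Fin d →₀ ℕ)

include hI in
theorem toSyn_exponentSum_lt (m m' : MonomialOrder (Fin d))
    (hne : standardExponents m I ≠ standardExponents m' I) :
    m.toSyn (exponentSum m I) < m.toSyn (exponentSum m' I) := by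
  classical
  have := finite_standardExponents hI m
  have := finite_standardExponents hI m'
  have := Fintype.ofFinite (standardExponents m I)
  have := Fintype.ofFinite (standardExponents m' I)
  obtain ⟨φ, hφ⟩ := exists_equiv_toSyn_le hI m m'
  obtain ⟨t, ht⟩ : ∃ t, (φ t : Fin d →₀ ℕ) ≠ t := by
    by_contra! hcon
    apply hne
    ext u
    constructor
    · intro hu
      have := hcon (φ.symm ⟨u, hu⟩)
      rw [Equiv.apply_symm_apply] at this
      rw [show u = _ from this]
      exact Subtype.coe_prop _
    · intro hu
      rw [show u = _ from (hcon ⟨u, hu⟩).symm]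
      exact Subtype.coe_prop _
  rw [exponentSum, exponentSum, finsum_eq_sum_of_fintype, finsum_eq_sum_of_fintype, map_sum, map_sum,
    ← φ.sum_comp]
  exact Finset.sum_lt_sum (fun t _ => hφ t)
    ⟨t, Finset.mem_univ _, lt_of_le_of_ne (hφ t) fun h => ht (m.toSyn.injective h)⟩

include hI in
-- The `t j + 1` powers of the variable `x_j` dividing a standard monomial are themselves standard.
theorem apply_lt_of_mem_standardExponents {t : Fin d →₀ ℕ} (ht : t ∈ standardExponents m I)
    (j : Fin d) : t j < n := by
  classical
  have := finite_standardExponents hI m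
  let f : Fin (t j + 1) → standardExponents m I := fun i =>
    ⟨Finsupp.single j (i : ℕ), standardExponents_downward ht (by
      rw [Finsupp.single_le_iff]; exact Nat.lt_succ_iff.1 i.2)⟩
  have hf : Function.Injective f := fun a b hab => by
    have h1 := congrArg Subtype.val hab
    exact Fin.ext (Finsupp.single_injective j h1)
  have h2 := Nat.card_le_card_of_injective f hf
  rw [card_standardExponents hI, Nat.card_eq_fintype_card, Fintype.card_fin] at h2
  omega

include hI in
theorem exponentSum_apply_le (m : MonomialOrder (Fin d)) (j : Fin d) :
    exponentSum m I j ≤ n ^ 2 := by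
  classical
  have := finite_standardExponents hI m
  have := Fintype.ofFinite (standardExponents m I)
  rw [exponentSum, finsum_eq_sum_of_fintype, Finsupp.finsetSum_apply, sq]
  calc _ ≤ ∑ _u : standardExponents m I, n :=
        Finset.sum_le_sum fun u _ => (apply_lt_of_mem_standardExponents hI u.2 j).le
    _ = n * n := by
        rw [Finset.sum_const, Finset.card_univ, ← Nat.card_eq_fintype_card,
          card_standardExponents hI, smul_eq_mul]

end Length

/-! ### Replacing a monomial order by a rational weight -/

theorem exists_weight (m : MonomialOrder (Fin d)) (A : Finset ((Fin d →₀ ℕ) × (Fin d →₀ ℕ)))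
    (hA : ∀ q ∈ A, m.toSyn q.1 < m.toSyn q.2) :
    ∃ w : Fin d → ℚ, ∀ q ∈ A, 0 < w ⬝ᵥ fun j => (q.2 j : ℚ) - q.1 j := by
  classical
  let δ : (Fin d →₀ ℕ) × (Fin d →₀ ℕ) → Fin d → ℚ := fun q j => (q.2 j : ℚ) - q.1 j
  -- `P` is the rational cone of order-positive directions. The factor `k` clears denominators, so
  -- that membership becomes a comparison of exponents; the zero vector is excluded because the
  -- order is strict.
  let P : (Fin d → ℚ) → Prop := fun a =>
    ∃ k : ℕ, 0 < k ∧ ∃ q : (Fin d →₀ ℕ) × (Fin d →₀ ℕ), m.toSyn q.1 < m.toSyn q.2 ∧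
      ∀ j, (k : ℚ) * a j = q.2 j - q.1 j
  have hnsmul : ∀ (k : ℕ) (q : (Fin d →₀ ℕ) × (Fin d →₀ ℕ)), 0 < k → m.toSyn q.1 < m.toSyn q.2 →
      m.toSyn (k • q.1) < m.toSyn (k • q.2) := fun k q hk hq => by
    rw [map_nsmul, map_nsmul]
    exact nsmul_lt_nsmul_right hk.ne' hq
  have hw : ∃ w : Module.Dual ℚ (Fin d → ℚ), ∀ a ∈ A.image δ, 0 < w a := by
    refine exists_dual_pos_of_blunt (K := ℚ) P ?_ ?_ ?_ (A.image δ) ?_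
    · rintro a b ⟨k, hk, q, hq, hka⟩ ⟨l, hl, r, hr, hlb⟩
      refine ⟨k * l, by positivity, (l • q.1 + k • r.1, l • q.2 + k • r.2), ?_, fun j => ?_⟩
      · simp only [map_add]
        exact add_lt_add (hnsmul l q hl hq) (hnsmul k r hk hr)
      · simp only [Finsupp.add_apply, Finsupp.smul_apply, smul_eq_mul, Pi.add_apply]
        push_cast
        linear_combination (l : ℚ) * hka j + (k : ℚ) * hlb j
    · rintro c a hc ⟨k, hk, q, hq, hka⟩
      have hnum : 0 < c.num := Rat.num_pos.2 hc
      refine ⟨k * c.den, Nat.mul_pos hk c.den_pos, (c.num.toNat • q.1, c.num.toNat • q.2),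
        hnsmul _ q (by omega) hq, fun j => ?_⟩
      have h1 : ((c.num.toNat : ℕ) : ℚ) = c.num := by
        exact_mod_cast congrArg (Int.cast : ℤ → ℚ) (Int.toNat_of_nonneg hnum.le)
      simp only [Finsupp.smul_apply, smul_eq_mul, Pi.smul_apply]
      push_cast
      rw [h1]
      have h2 : (c.den : ℚ) * c = c.num := Rat.den_mul_eq_num c
      linear_combination (c.num : ℚ) * hka j + (k : ℚ) * a j * h2
    · rintro ⟨k, hk, q, hq, hk0⟩
      apply hq.ne
      congr 1
      ext j
      have := hk0 j
      simp only [Pi.zero_apply, mul_zero] at this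
      exact_mod_cast (sub_eq_zero.1 this.symm).symm
    · intro a ha
      obtain ⟨q, hq, rfl⟩ := Finset.mem_image.1 ha
      exact ⟨1, one_pos, q, hA q hq, fun j => by simp [δ]⟩
  obtain ⟨w, hw⟩ := hw
  obtain ⟨y, rfl⟩ := (dotProductEquiv ℚ (Fin d)).surjective w
  exact ⟨y, fun q hq => hw _ (Finset.mem_image_of_mem δ hq)⟩

/-- The exponent vector of `exponentSum`, with integer entries. -/
noncomputable def exponentPoint (m : MonomialOrder (Fin d))
    (I : Ideal (MvPolynomial (Fin d) F)) : Fin d → ℤ :=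
  fun j => exponentSum m I j

theorem exists_positive_weight {n : ℕ} (hI : I ∈ Hilb F n d) (m : MonomialOrder (Fin d))
    (V : Finset (Fin d → ℤ))
    (hV : ∀ p ∈ V, ∃ m' : MonomialOrder.{0, 0} (Fin d), p = exponentPoint m' I) :
    ∃ w : Fin d → ℚ, (∀ j, 0 < w j) ∧ ∀ p ∈ V, p ≠ exponentPoint m I →
      0 < w ⬝ᵥ intVecToRat d (p - exponentPoint m I) := by
  classical
  have hlift : ∀ p, ∃ q : Fin d →₀ ℕ, p ∈ V →
      (∀ j, (q j : ℤ) = p j) ∧ (p ≠ exponentPoint m I → m.toSyn (exponentSum m I) < m.toSyn q) := by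
    intro p
    by_cases hp : p ∈ V
    · obtain ⟨m', rfl⟩ := hV p hp
      refine ⟨exponentSum m' I, fun _ => ⟨fun j => rfl, fun hne => ?_⟩⟩
      refine toSyn_exponentSum_lt hI m m' fun h => hne ?_
      have h2 : exponentSum m' I = exponentSum m I := by rw [exponentSum, exponentSum, h]
      exact funext fun j => congrArg (fun e : Fin d →₀ ℕ => ((e j : ℕ) : ℤ)) h2
    · exact ⟨0, fun h => absurd h hp⟩
  choose q hq using hlift
  -- The comparisons of `0` with the unit exponents are included to force the weight to be positive.
  obtain ⟨w, hw⟩ := exists_weight m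
    (((V.filter fun p => p ≠ exponentPoint m I).image fun p => (exponentSum m I, q p)) ∪
      Finset.univ.image fun j => (0, Finsupp.single j 1)) (by
      intro r hr
      rcases Finset.mem_union.1 hr with h | h
      · obtain ⟨p, hp, rfl⟩ := Finset.mem_image.1 h
        exact (hq p (Finset.mem_filter.1 hp).1).2 (Finset.mem_filter.1 hp).2
      · obtain ⟨j, -, rfl⟩ := Finset.mem_image.1 h
        simp only [map_zero]
        rw [m.toSyn_lt_iff_ne_zero]
        simp)
  refine ⟨w, fun j => ?_, fun p hp hne => ?_⟩
  · have h1 := hw (0, Finsupp.single j 1)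
      (Finset.mem_union_right _ (Finset.mem_image_of_mem _ (Finset.mem_univ j)))
    have h2 : (fun i => (((Finsupp.single j 1 : Fin d →₀ ℕ) i : ℕ) : ℚ) -
        (((0 : Fin d →₀ ℕ) i : ℕ) : ℚ)) = Pi.single j 1 := by
      ext i
      by_cases h : i = j
      · subst h; simp
      · simp [h]
    simp only [h2] at h1
    simpa using h1
  · have h1 := hw (exponentSum m I, q p) (Finset.mem_union_left _
      (Finset.mem_image_of_mem _ (Finset.mem_filter.2 ⟨hp, hne⟩)))
    convert h1 using 2
    ext j
    simp [← (hq p hp).1 j, exponentPoint]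

/-! ### Reduced bases are determined by the standard monomials -/

section ReducedBasis

variable {G : Set (MvPolynomial (Fin d) F)}

theorem exists_degree_le (hG : IsGroebnerBasis m I G) {t : Fin d →₀ ℕ}
    (ht : t ∈ leadingExponents m I) : ∃ g ∈ G, m.degree g ≤ t := by
  obtain ⟨f, hfI, hf0, rfl⟩ := ht
  have h1 : monomial (m.degree f) (1 : F) ∈ initialIdeal m G := by
    rw [hG.initialIdeal_eq]
    exact Ideal.subset_span ⟨f, ⟨hfI, hf0⟩, rfl⟩
  have h2 : initialMonomial m '' {f ∈ G | f ≠ 0} =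
      (fun s => monomial s (1 : F)) '' (m.degree '' {f ∈ G | f ≠ 0}) := by
    rw [Set.image_image]; rfl
  rw [initialIdeal, h2, mem_ideal_span_monomial_image] at h1
  obtain ⟨_, ⟨g, hg, rfl⟩, hle⟩ := h1 (m.degree f) (by simp)
  exact ⟨g, hg.1, hle⟩

theorem IsReducedGroebnerBasis.ne_zero (hG : IsReducedGroebnerBasis m I G)
    {g : MvPolynomial (Fin d) F} (hg : g ∈ G) : g ≠ 0 := by
  rintro rfl
  have := hG.leadingCoeff_eq_one _ hg
  simp at this

theorem IsReducedGroebnerBasis.degree_mem (hG : IsReducedGroebnerBasis m I G)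
    {g : MvPolynomial (Fin d) F} (hg : g ∈ G) : m.degree g ∈ leadingExponents m I :=
  ⟨g, hG.subset hg, hG.ne_zero hg, rfl⟩

theorem IsReducedGroebnerBasis.mem_standardExponents (hG : IsReducedGroebnerBasis m I G)
    {g : MvPolynomial (Fin d) F} (hg : g ∈ G) {u : Fin d →₀ ℕ} (hu : u ∈ g.support)
    (hne : u ≠ m.degree g) : u ∈ standardExponents m I := by
  intro hL
  obtain ⟨h, hh, hle⟩ := exists_degree_le hG.toIsGroebnerBasis hL
  by_cases hhg : h = g
  · subst hhg
    exact hne (m.toSyn.injective (le_antisymm (m.le_degree hu) (m.toSyn_monotone hle)))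
  · exact hG.not_degree_le g hg h hh hhg u hu hle

theorem IsReducedGroebnerBasis.degree_minimal (hG : IsReducedGroebnerBasis m I G)
    {g : MvPolynomial (Fin d) F} (hg : g ∈ G) {t : Fin d →₀ ℕ}
    (ht : t ∈ leadingExponents m I) (hle : t ≤ m.degree g) : t = m.degree g := by
  obtain ⟨h, hh, hht⟩ := exists_degree_le hG.toIsGroebnerBasis ht
  by_cases hhg : h = g
  · subst hhg
    exact le_antisymm hle hht
  · exact absurd (hht.trans hle) (hG.not_degree_le g hg h hh hhg _
      (m.degree_mem_support (hG.ne_zero hg)))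

theorem IsReducedGroebnerBasis.degree_injOn (hG : IsReducedGroebnerBasis m I G) :
    Set.InjOn m.degree G := by
  intro g hg h hh hgh
  by_contra hne
  exact hG.not_degree_le h hh g hg hne _ (m.degree_mem_support (hG.ne_zero hh)) hgh.le

/-- Minimality matches each `g` with a `g'` of the same degree. Their monic leading terms cancel, so
`g - g'` is a member of `I` supported on standard monomials, hence zero. -/
theorem IsReducedGroebnerBasis.subset_of_standardExponents_eq {m' : MonomialOrder (Fin d)}
    {G' : Set (MvPolynomial (Fin d) F)} (hG : IsReducedGroebnerBasis m I G)
    (hG' : IsReducedGroebnerBasis m' I G')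
    (heq : standardExponents m I = standardExponents m' I) : G ⊆ G' := by
  intro g hg
  have hL : leadingExponents m I = leadingExponents m' I := compl_injective heq
  obtain ⟨g', hg', hle⟩ := exists_degree_le hG'.toIsGroebnerBasis (hL ▸ hG.degree_mem hg)
  have hdeg : m'.degree g' = m.degree g :=
    hG.degree_minimal hg (hL.symm ▸ hG'.degree_mem hg') hle
  have h0 : g - g' = 0 := by
    refine eq_zero_of_mem_of_support_subset (m := m) (I.sub_mem (hG.subset hg) (hG'.subset hg'))
      fun u hu => ?_
    rw [mem_support_iff, coeff_sub] at hu
    by_cases hu0 : u = m.degree g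
    · exfalso
      apply hu
      have h1 : g.coeff u = 1 := by rw [hu0]; exact hG.leadingCoeff_eq_one g hg
      have h2 : g'.coeff u = 1 := by rw [hu0, ← hdeg]; exact hG'.leadingCoeff_eq_one g' hg'
      rw [h1, h2, sub_self]
    · by_cases hgu : g.coeff u = 0
      · have : g'.coeff u ≠ 0 := fun h => hu (by rw [hgu, h, sub_zero])
        rw [heq]
        exact hG'.mem_standardExponents hg' (mem_support_iff.2 this) (by rwa [hdeg])
      · exact hG.mem_standardExponents hg (mem_support_iff.2 hgu) hu0
  rwa [sub_eq_zero.1 h0]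

end ReducedBasis

end HilbertGroebner

/-! ### Size of one reduced basis -/

/-- The minimal elements of the complement of a finite down-closed set of `n` exponents: few of
them have a large coordinate, and the others are determined by all but one coordinate. -/
theorem card_le_of_antichain {D n K : ℕ} (Λ M : Finset (Fin (D + 1) →₀ ℕ)) (hΛ : Λ.card ≤ n)
    (hM : ∀ t ∈ M, ∀ s, s ≤ t → s ≠ t → s ∈ Λ) (hMΛ : ∀ t ∈ M, t ∉ Λ) :
    (M.card : ℝ) * K ≤ (D + 1) * n + (K : ℝ) ^ D * K := by
  classical
  have hanti : ∀ s ∈ M, ∀ t ∈ M, s ≤ t → s = t := fun s hs t ht hst => by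
    by_contra hne
    exact hMΛ s hs (hM t ht s hst hne)
  -- Descending from `t` along `e_j` by `1, …, K` steps stays in `Λ`. Elements of `M` on a common
  -- line in direction `e_j` are comparable, hence equal, so all these exponents are distinct.
  have hlarge : ∀ j, (M.filter fun t => K ≤ t j).card * K ≤ n := fun j => by
    rw [← Finset.card_range K, ← Finset.card_product]
    refine le_trans (Finset.card_le_card_of_injOn
      (fun q => q.1 - Finsupp.single j (q.2 + 1)) ?_ ?_) hΛ
    · rintro ⟨t, i⟩ hq
      simp only [Finset.coe_product, Set.mem_prod, Finset.mem_coe, Finset.mem_filter,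
        Finset.mem_range, Finset.card_range] at hq
      refine hM t hq.1.1 _ tsub_le_self fun h => ?_
      have := DFunLike.congr_fun h j
      simp only [Finsupp.tsub_apply, Finsupp.single_eq_same] at this
      omega
    · rintro ⟨t, i⟩ hq ⟨t', i'⟩ hq' heq
      simp only [Finset.coe_product, Set.mem_prod, Finset.mem_coe, Finset.mem_filter,
        Finset.mem_range, Finset.card_range] at hq hq' heq
      have hoff : ∀ k, k ≠ j → t k = t' k := fun k hk => by
        have := DFunLike.congr_fun heq k
        simpa [Finsupp.tsub_apply, Finsupp.single_eq_of_ne hk] using this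
      have htt : t = t' := by
        rcases le_total (t j) (t' j) with h | h
        · refine hanti t hq.1.1 t' hq'.1.1 fun k => ?_
          by_cases hk : k = j
          · rwa [hk]
          · exact (hoff k hk).le
        · refine (hanti t' hq'.1.1 t hq.1.1 fun k => ?_).symm
          by_cases hk : k = j
          · rwa [hk]
          · exact (hoff k hk).ge
      have := DFunLike.congr_fun heq j
      simp only [Finsupp.tsub_apply, Finsupp.single_eq_same, ← htt] at this
      refine Prod.ext htt ?_
      show i = i'
      have h1 := hq.1.2
      have h2 := hq.2
      have h3 := hq'.2
      omega
  have hsmall : (M.filter fun t => ∀ j, t j < K).card ≤ K ^ D := by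
    have h1 : (Fintype.piFinset fun _ : Fin D => Finset.range K).card = K ^ D := by simp
    rw [← h1]
    refine Finset.card_le_card_of_injOn (fun t i => t i.succ) ?_ ?_
    · intro t ht
      simp only [Finset.coe_filter, Set.mem_ofPred_eq] at ht
      simpa using fun i : Fin D => ht.2 i.succ
    · intro t ht t' ht' heq
      simp only [Finset.coe_filter, Set.mem_ofPred_eq] at ht ht'
      have hs : ∀ i : Fin D, t i.succ = t' i.succ := fun i => congrFun heq i
      rcases le_total (t 0) (t' 0) with h | h
      · exact hanti t ht.1 t' ht'.1 fun k => Fin.cases h (fun i => (hs i).le) k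
      · exact (hanti t' ht'.1 t ht.1 fun k => Fin.cases h (fun i => (hs i).ge) k).symm
  have hcover : M ⊆ (Finset.univ.biUnion fun j => M.filter fun t => K ≤ t j) ∪
      M.filter fun t => ∀ j, t j < K := by
    intro t ht
    by_cases h : ∀ j, t j < K
    · exact Finset.mem_union_right _ (by simp [ht, h])
    · push Not at h
      obtain ⟨j, hj⟩ := h
      exact Finset.mem_union_left _ (by simp only [Finset.mem_biUnion]; exact ⟨j, by simp, by simp [ht, hj]⟩)
  have h1 : M.card * K ≤ (D + 1) * n + K ^ D * K := by
    calc M.card * K ≤ ((∑ j : Fin (D + 1), (M.filter fun t => K ≤ t j).card) + K ^ D) * K := by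
          gcongr
          exact (Finset.card_le_card hcover).trans ((Finset.card_union_le _ _).trans
            (add_le_add Finset.card_biUnion_le hsmall))
      _ = (∑ j : Fin (D + 1), (M.filter fun t => K ≤ t j).card * K) + K ^ D * K := by
          rw [add_mul, Finset.sum_mul]
      _ ≤ (∑ _j : Fin (D + 1), n) + K ^ D * K := by
          gcongr with j
          exact hlarge j
      _ = _ := by simp
  exact_mod_cast h1

theorem card_le_rpow_of_antichain {d : ℕ} (hd : 1 ≤ d) {n : ℕ} (hn : 1 ≤ n)
    (Λ M : Finset (Fin d →₀ ℕ)) (hΛ : Λ.card ≤ n)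
    (hM : ∀ t ∈ M, ∀ s, s ≤ t → s ≠ t → s ∈ Λ) (hMΛ : ∀ t ∈ M, t ∉ Λ) :
    (M.card : ℝ) ≤ (d + 2 ^ d) * (n : ℝ) ^ (((d : ℝ) - 1) / d) := by
  obtain ⟨D, rfl⟩ : ∃ D, d = D + 1 := ⟨d - 1, by omega⟩
  have hnR : (1 : ℝ) ≤ n := by exact_mod_cast hn
  have hn0 : (0 : ℝ) < n := by linarith
  set x : ℝ := (n : ℝ) ^ (((D : ℝ) + 1)⁻¹) with hx
  have hx1 : 1 ≤ x := Real.one_le_rpow hnR (by positivity)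
  have hx0 : 0 < x := by linarith
  have hxD : x ^ (D + 1) = n := by
    rw [hx, ← Real.rpow_natCast, ← Real.rpow_mul hn0.le]
    push_cast
    rw [inv_mul_cancel₀ (by positivity), Real.rpow_one]
  have hxe : (n : ℝ) ^ ((((D + 1 : ℕ) : ℝ) - 1) / ((D + 1 : ℕ) : ℝ)) = x ^ D := by
    rw [hx, ← Real.rpow_natCast, ← Real.rpow_mul hn0.le]
    congr 1
    push_cast
    field_simp
    ring
  -- The threshold `x = n^(1/d)` balances `n / K` against `K^(d-1)`; rounding up costs at most a
  -- factor of two.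
  set K := ⌈x⌉₊ with hK
  have hKx : x ≤ K := Nat.le_ceil x
  have hK2 : (K : ℝ) ≤ 2 * x := by
    have := Nat.ceil_lt_add_one hx0.le
    linarith
  have hK0 : (0 : ℝ) < K := by linarith
  have h := card_le_of_antichain (K := K) Λ M hΛ hM hMΛ
  rw [hxe]
  refine le_of_mul_le_mul_right (h.trans ?_) hK0
  have hsplit : (((D + 1 : ℕ) : ℝ) + 2 ^ (D + 1)) * x ^ D * K =
      ((D + 1 : ℕ) : ℝ) * x ^ D * K + 2 ^ (D + 1) * x ^ D * K := by ring
  rw [hsplit]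
  refine add_le_add ?_ ?_
  · rw [← hxD, pow_succ]
    push_cast
    have : x ^ D * x ≤ x ^ D * K := by gcongr
    calc ((D : ℝ) + 1) * (x ^ D * x) ≤ ((D : ℝ) + 1) * (x ^ D * K) := by gcongr
      _ = _ := by ring
  · have h1 : (K : ℝ) ^ D ≤ (2 * x) ^ D := by gcongr
    have h2 : (2 : ℝ) ^ D ≤ 2 ^ (D + 1) := by gcongr <;> norm_num
    calc (K : ℝ) ^ D * K ≤ (2 * x) ^ D * K := by gcongr
      _ = 2 ^ D * x ^ D * K := by rw [mul_pow]
      _ ≤ _ := by gcongr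

namespace HilbertGroebner

variable {F : Type*} [Field F] {d : ℕ} {n : ℕ} {I : Ideal (MvPolynomial (Fin d) F)}

theorem IsReducedGroebnerBasis.ncard_le {m : MonomialOrder (Fin d)}
    {G : Set (MvPolynomial (Fin d) F)} (hd : 1 ≤ d) (hn : 1 ≤ n) (hI : I ∈ Hilb F n d)
    (hG : IsReducedGroebnerBasis m I G) :
    (G.ncard : ℝ) ≤ (d + 2 ^ d) * (n : ℝ) ^ (((d : ℝ) - 1) / d) := by
  classical
  have hfin : (standardExponents m I).Finite :=
    Set.finite_coe_iff.1 (finite_standardExponents hI m)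
  have hΛ : hfin.toFinset.card ≤ n := by
    rw [← Set.ncard_eq_toFinset_card _ hfin, ← Nat.card_coe_set_eq, card_standardExponents hI]
  have h := card_le_rpow_of_antichain hd hn hfin.toFinset (hG.finite.toFinset.image m.degree) hΛ
    (fun t ht s hst hne => ?_) (fun t ht => ?_)
  · rwa [Finset.card_image_of_injOn (by simpa using hG.degree_injOn),
      ← Set.ncard_eq_toFinset_card _ hG.finite] at h
  · obtain ⟨g, hg, rfl⟩ := Finset.mem_image.1 ht
    rw [Set.Finite.mem_toFinset] at hg ⊢
    exact fun hL => hne (hG.degree_minimal hg hL hst)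
  · obtain ⟨g, hg, rfl⟩ := Finset.mem_image.1 ht
    rw [Set.Finite.mem_toFinset] at hg ⊢
    exact fun hs => hs (hG.degree_mem hg)

/-! ### Counting reduced bases and the universal basis -/

/-- The exponent points of `I` under all monomial orders. -/
def exponentPoints (I : Ideal (MvPolynomial (Fin d) F)) : Set (Fin d → ℤ) :=
  {p | ∃ m : MonomialOrder.{0, 0} (Fin d), p = exponentPoint m I}

theorem exponentPoint_mem_Icc (hI : I ∈ Hilb F n d) (m : MonomialOrder (Fin d)) (j : Fin d) :
    0 ≤ exponentPoint m I j ∧ exponentPoint m I j ≤ ((n ^ 2 : ℕ) : ℤ) :=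
  ⟨Int.natCast_nonneg _, Int.ofNat_le.2 (exponentSum_apply_le hI m j)⟩

theorem finite_exponentPoints (hI : I ∈ Hilb F n d) : (exponentPoints I).Finite := by
  refine (Set.finite_Icc (0 : Fin d → ℤ) fun _ => ((n ^ 2 : ℕ) : ℤ)).subset ?_
  rintro _ ⟨m, rfl⟩
  exact ⟨fun j => (exponentPoint_mem_Icc hI m j).1, fun j => (exponentPoint_mem_Icc hI m j).2⟩

theorem standardExponents_eq_of_exponentPoint_eq (hI : I ∈ Hilb F n d) {m m' : MonomialOrder (Fin d)}
    (h : exponentPoint m I = exponentPoint m' I) :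
    standardExponents m I = standardExponents m' I := by
  by_contra hne
  refine (toSyn_exponentSum_lt hI m m' hne).ne (congrArg _ ?_)
  ext j
  exact Int.ofNat_inj.1 (congrFun h j)

theorem exists_injOn_exponentPoints (hI : I ∈ Hilb F n d) :
    ∃ f : Set (MvPolynomial (Fin d) F) → Fin d → ℤ,
      Set.MapsTo f (reducedGroebnerBases I) (exponentPoints I) ∧
      Set.InjOn f (reducedGroebnerBases I) := by
  have hex : ∀ G, ∃ p : Fin d → ℤ, G ∈ reducedGroebnerBases I →
      ∃ m : MonomialOrder.{0, 0} (Fin d), IsReducedGroebnerBasis m I G ∧ p = exponentPoint m I := by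
    intro G
    by_cases hG : G ∈ reducedGroebnerBases I
    · obtain ⟨m, hm⟩ := hG
      exact ⟨exponentPoint m I, fun _ => ⟨m, hm, rfl⟩⟩
    · exact ⟨0, fun h => absurd h hG⟩
  choose f hf using hex
  refine ⟨f, fun G hG => ?_, fun G hG G' hG' h => ?_⟩
  · obtain ⟨m, -, hm⟩ := hf G hG
    exact ⟨m, hm⟩
  · obtain ⟨m, hGm, hm⟩ := hf G hG
    obtain ⟨m', hGm', hm'⟩ := hf G' hG'
    rw [hm, hm'] at h
    have hs := standardExponents_eq_of_exponentPoint_eq hI h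
    exact Set.Subset.antisymm (hGm.subset_of_standardExponents_eq hGm' hs)
      (hGm'.subset_of_standardExponents_eq hGm hs.symm)

theorem finite_reducedGroebnerBases (hI : I ∈ Hilb F n d) : (reducedGroebnerBases I).Finite := by
  obtain ⟨f, hf, hinj⟩ := exists_injOn_exponentPoints hI
  exact Set.Finite.of_injOn hf hinj (finite_exponentPoints hI)

theorem exists_ncard_reducedGroebnerBases_le (d : ℕ) (hd : 1 ≤ d) :
    ∃ C : ℝ, 0 ≤ C ∧ ∀ (F : Type*) [Field F] (n : ℕ), 1 ≤ n → ∀ I ∈ Hilb F n d,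
      ((reducedGroebnerBases I).ncard : ℝ) ≤
        C * (n : ℝ) ^ (2 * (d : ℝ) * (((d : ℝ) - 1) / ((d : ℝ) + 1))) := by
  obtain ⟨C, hC0, hC⟩ := card_le_of_positive_weights d hd
  refine ⟨C, hC0, fun F _ n hn I hI => ?_⟩
  obtain ⟨f, hf, hinj⟩ := exists_injOn_exponentPoints hI
  have hfin := finite_exponentPoints hI
  have h1 : (reducedGroebnerBases I).ncard ≤ hfin.toFinset.card := by
    rw [← Set.ncard_eq_toFinset_card _ hfin]
    exact Set.ncard_le_ncard_of_injOn f hf hinj hfin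
  have hV : ∀ p ∈ hfin.toFinset, ∃ m : MonomialOrder.{0, 0} (Fin d), p = exponentPoint m I :=
    fun p hp => hfin.mem_toFinset.1 hp
  -- Each coordinate of a point sums `n` exponents below `n`, so the cube has side `n ^ 2`; this
  -- doubles the exponent in the vertex bound.
  have h2 := hC (n ^ 2) (Nat.one_le_pow _ _ hn) hfin.toFinset
    (fun p hp i => by
      obtain ⟨m, rfl⟩ := hV p hp
      exact exponentPoint_mem_Icc hI m i)
    (fun v hv => by
      obtain ⟨m, rfl⟩ := hV v hv
      exact exists_positive_weight hI m _ hV)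
  calc ((reducedGroebnerBases I).ncard : ℝ) ≤ hfin.toFinset.card := by exact_mod_cast h1
    _ ≤ _ := h2
    _ = _ := by
        push_cast
        rw [← Real.rpow_natCast (n : ℝ) 2, ← Real.rpow_mul (Nat.cast_nonneg n)]
        congr 2
        push_cast
        ring

theorem finite_universalGroebnerBasis (hI : I ∈ Hilb F n d) : (universalGroebnerBasis I).Finite := by
  refine (finite_reducedGroebnerBases hI).sUnion ?_
  rintro G ⟨m, hG⟩
  exact hG.finite

theorem ncard_universalGroebnerBasis_le (hd : 1 ≤ d) (hn : 1 ≤ n) (hI : I ∈ Hilb F n d) :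
    ((universalGroebnerBasis I).ncard : ℝ) ≤ (reducedGroebnerBases I).ncard *
      ((d + 2 ^ d) * (n : ℝ) ^ (((d : ℝ) - 1) / d)) := by
  classical
  have hR := finite_reducedGroebnerBases hI
  have hU := finite_universalGroebnerBasis hI
  have hsub : hU.toFinset ⊆ hR.toFinset.biUnion fun G => hU.toFinset.filter (· ∈ G) := by
    intro g hg
    obtain ⟨G, hG, hgG⟩ := hU.mem_toFinset.1 hg
    exact Finset.mem_biUnion.2 ⟨G, hR.mem_toFinset.2 hG, Finset.mem_filter.2 ⟨hg, hgG⟩⟩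
  rw [Set.ncard_eq_toFinset_card _ hU, Set.ncard_eq_toFinset_card _ hR]
  calc (hU.toFinset.card : ℝ)
      ≤ ((∑ G ∈ hR.toFinset, (hU.toFinset.filter (· ∈ G)).card : ℕ) : ℝ) :=
        Nat.cast_le.2 ((Finset.card_le_card hsub).trans Finset.card_biUnion_le)
    _ ≤ ∑ _G ∈ hR.toFinset, ((d + 2 ^ d) * (n : ℝ) ^ (((d : ℝ) - 1) / d)) := by
        rw [Nat.cast_sum]
        refine Finset.sum_le_sum fun G hG => ?_
        obtain ⟨m, hGm⟩ := hR.mem_toFinset.1 hG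
        refine le_trans (Nat.cast_le.2 ?_) (hGm.ncard_le hd hn hI)
        rw [Set.ncard_eq_toFinset_card _ hGm.finite]
        exact Finset.card_le_card fun g hg => hGm.finite.mem_toFinset.2 (Finset.mem_filter.1 hg).2
    _ = _ := by rw [Finset.sum_const, nsmul_eq_mul]

end HilbertGroebner

theorem corollary2p5 (d : ℕ) (hd : 1 ≤ d) :
    (∃ C : ℝ, ∀ (F : Type*) [Field F] (n : ℕ), 1 ≤ n →
      ∀ I ∈ HilbertGroebner.Hilb F n d,
        (HilbertGroebner.reducedGroebnerBases I).Finite ∧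
        ((HilbertGroebner.reducedGroebnerBases I).ncard : ℝ) ≤
          C * (n : ℝ) ^ (2 * (d : ℝ) * (((d : ℝ) - 1) / ((d : ℝ) + 1)))) ∧
    (∃ C : ℝ, ∀ (F : Type*) [Field F] (n : ℕ), 1 ≤ n →
      ∀ I ∈ HilbertGroebner.Hilb F n d,
        (HilbertGroebner.universalGroebnerBasis I).Finite ∧
        ((HilbertGroebner.universalGroebnerBasis I).ncard : ℝ) ≤
          C * (n : ℝ) ^ (2 * (d : ℝ) - 3 + (3 * (d : ℝ) - 1) / ((d : ℝ) * ((d : ℝ) + 1)))) := by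
  constructor
  · obtain ⟨C, -, hC⟩ := HilbertGroebner.exists_ncard_reducedGroebnerBases_le d hd
    exact ⟨C, fun F _ n hn I hI =>
      ⟨HilbertGroebner.finite_reducedGroebnerBases hI, hC F n hn I hI⟩⟩
  · obtain ⟨C, -, hC⟩ := HilbertGroebner.exists_ncard_reducedGroebnerBases_le d hd
    refine ⟨C * (d + 2 ^ d), fun F _ n hn I hI =>
      ⟨HilbertGroebner.finite_universalGroebnerBasis hI,
        (HilbertGroebner.ncard_universalGroebnerBasis_le hd hn hI).trans ?_⟩⟩
    have hn0 : (0 : ℝ) < n := by exact_mod_cast hn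
    have hd0 : (0 : ℝ) < d := by exact_mod_cast hd
    have he : 2 * (d : ℝ) - 3 + (3 * (d : ℝ) - 1) / ((d : ℝ) * ((d : ℝ) + 1)) =
        2 * (d : ℝ) * (((d : ℝ) - 1) / ((d : ℝ) + 1)) + ((d : ℝ) - 1) / d := by
      field_simp
      ring
    calc _ ≤ C * (n : ℝ) ^ (2 * (d : ℝ) * (((d : ℝ) - 1) / ((d : ℝ) + 1))) *
          ((d + 2 ^ d) * (n : ℝ) ^ (((d : ℝ) - 1) / d)) := by
          gcongr
          exact hC F n hn I hI
      _ = _ := by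
          rw [he, Real.rpow_add hn0]
          ring
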